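/- For a finite abstract simplicial complex $K$, a \emph{Morse matching} on $K$ is a set $M$ of edges of the Hasse diagram of $K$ (pairs $(\sigma,\tau)$ of simplices with $\sigma\subset\tau$ and $\dim\tau=\dim\sigma+1$), no two of which share an endpoint, such that reversing the direction of the edges of $M$ in the Hasse diagram (with edges directed from each simplex to its faces of codimension one) yields a directed acyclic graph. The simplices not matched by $M$ are called \emph{critical}. The problem \textsc{Min-Morse Matching} on $2$-complexes asks, given a finite simplicial complex $K$ of dimension at most $2$ as a list of its simplices, for a Morse matching on $K$ with the minimum number $\mathrm{OPT}(K)$ of critical simplices. \textbf{Theorem.} There exists an $O\!\left(\frac{n}{\log n}\right)$-factor approximation algorithm for \textsc{Min-Morse Matching} on $2$-complexes, where $n$ denotes the number of $2$-simplices of the input complex. That is, there are a function $\alpha:\mathbb N\to\mathbb R$ with $\alpha(n)=O\!\left(\frac{n}{\log n}\right)$ as $n\to\infty$ and a polynomial-time algorithm that, for every finite simplicial complex $K$ of dimension at most $2$ with $n$ simplices of dimension $2$, outputs a Morse matching on $K$ with at most $\alpha(n)\cdot\mathrm{OPT}(K)$ critical simplices. -/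

import Mathlib

open Asymptotics

/-! ## Morse matchings on simplicial complexes -/

namespace PreAbstractSimplicialComplex

variable {V : Type*}

/-- `σ` is a facet of `τ` in `K`: both are simplices of `K`, and `σ` is a face of `τ` of
codimension one. These pairs are the edges of the Hasse diagram of `K`. -/
def IsFacet (K : PreAbstractSimplicialComplex V) (σ τ : Finset V) : Prop :=
  σ ∈ K.faces ∧ τ ∈ K.faces ∧ σ ⊆ τ ∧ τ.card = σ.card + 1

/-- The arcs of the directed graph obtained from the Hasse diagram of `K` (arcs from a simplex to
its facets) by reversing the arcs that belong to `M`. A pair `(σ, τ)` in `M` stands for the edge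
joining `τ` with its facet `σ`. -/
def ReversedHasse (K : PreAbstractSimplicialComplex V) (M : Set (Finset V × Finset V))
    (a b : Finset V) : Prop :=
  (K.IsFacet b a ∧ (b, a) ∉ M) ∨ (K.IsFacet a b ∧ (a, b) ∈ M)

/-- `M` is a Morse matching on `K`: a set of edges of the Hasse diagram, no two of which share an
endpoint, such that reversing the edges of `M` leaves the Hasse diagram without directed cycles. -/
structure IsMorseMatching (K : PreAbstractSimplicialComplex V)
    (M : Set (Finset V × Finset V)) : Prop where
  isFacet : ∀ p ∈ M, K.IsFacet p.1 p.2
  disjoint : ∀ p ∈ M, ∀ q ∈ M, p ≠ q → p.1 ≠ q.1 ∧ p.1 ≠ q.2 ∧ p.2 ≠ q.1 ∧ p.2 ≠ q.2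
  acyclic : ∀ σ, ¬ Relation.TransGen (K.ReversedHasse M) σ σ

/-- The critical simplices of `M`: the simplices of `K` that are not matched by `M`. -/
def criticalSimplices (K : PreAbstractSimplicialComplex V) (M : Set (Finset V × Finset V)) :
    Set (Finset V) :=
  {σ | σ ∈ K.faces ∧ ∀ p ∈ M, σ ≠ p.1 ∧ σ ≠ p.2}

/-- The simplices of `K` of dimension `d`. -/
def simplicesOfDim (K : PreAbstractSimplicialComplex V) (d : ℕ) : Set (Finset V) :=
  {σ | σ ∈ K.faces ∧ σ.card = d + 1}

end PreAbstractSimplicialComplex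

/-- A finite simplicial complex of dimension at most two as it is given to an algorithm: the
vertices are natural numbers, and the simplices are listed without repetition in some order. -/
structure TwoComplex extends PreAbstractSimplicialComplex ℕ where
  list : List (Finset ℕ)
  nodup_list : list.Nodup
  mem_list : ∀ σ, σ ∈ list ↔ σ ∈ faces
  card_le_three : ∀ σ ∈ faces, σ.card ≤ 3

/-- The number of two-dimensional simplices. -/
noncomputable def TwoComplex.numTwoSimplices (K : TwoComplex) : ℕ :=
  (K.simplicesOfDim 2).ncard

/-! ## A model of computation with a step count

Programs of a WHILE language over binary trees, in point-free form. Every construct is charged the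
size of the tree it is applied to, on top of the cost of its subprograms. Hence a run of cost `t`
only builds trees of size at most `t`, and can be simulated by a Turing machine on the bracket
strings of these trees with polynomial overhead; conversely, a Turing machine is simulated with
polynomial overhead by keeping its tapes as lists. Polynomial time in this model is therefore
polynomial time on Turing machines. -/

/-- Binary trees, the values handled by programs. -/
inductive Datum : Type
  | nil : Datum
  | cons : Datum → Datum → Datum
  deriving DecidableEq

namespace Datum

/-- The number of nodes. -/
def size : Datum → ℕ
  | nil => 1
  | cons a b => size a + size b + 1

/-- The left subtree (`nil` for `nil`). -/
def hd : Datum → Datum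
  | nil => nil
  | cons a _ => a

/-- The right subtree (`nil` for `nil`). -/
def tl : Datum → Datum
  | nil => nil
  | cons _ b => b

/-- The truth values: `nil` is false, and the value chosen for true is `cons nil nil`. -/
def ofBool : Bool → Datum
  | false => nil
  | true => cons nil nil

/-- Whether the two immediate subtrees are equal. -/
def eqTest : Datum → Datum
  | nil => nil
  | cons a b => ofBool (decide (a = b))

/-- Lists, written as right combs. -/
def ofList : List Datum → Datum
  | [] => nil
  | a :: l => cons a (ofList l)

/-- Natural numbers in binary, least significant bit first. -/
def ofNat (m : ℕ) : Datum := ofList (m.bits.map ofBool)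

/-- Finite sets of natural numbers, as increasing lists. -/
def ofFinset (s : Finset ℕ) : Datum := ofList ((s.sort (· ≤ ·)).map ofNat)

/-- Pairs of simplices. -/
def ofPair (p : Finset ℕ × Finset ℕ) : Datum := cons (ofFinset p.1) (ofFinset p.2)

theorem ofBool_injective : Function.Injective ofBool := by
  intro a b h
  cases a <;> cases b <;> simp_all [ofBool]

theorem ofList_injective : Function.Injective ofList := by
  intro l
  induction l with
  | nil => intro l' h; cases l' <;> simp_all [ofList]
  | cons a l ih =>
    intro l' h
    cases l' with
    | nil => simp [ofList] at h
    | cons b l' =>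
      simp only [ofList, Datum.cons.injEq] at h
      rw [h.1, ih h.2]

theorem ofNat_injective : Function.Injective ofNat := by
  intro a b h
  have hb : a.bits = b.bits := ofBool_injective.list_map (ofList_injective h)
  apply Nat.eq_of_testBit_eq
  intro i
  rw [Nat.testBit_eq_inth, Nat.testBit_eq_inth, hb]

theorem ofFinset_injective : Function.Injective ofFinset := by
  intro s t h
  have hl : s.sort (· ≤ ·) = t.sort (· ≤ ·) := ofNat_injective.list_map (ofList_injective h)
  rw [← Finset.sort_toFinset s (· ≤ ·), hl, Finset.sort_toFinset]

theorem ofPair_injective : Function.Injective ofPair := by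
  rintro ⟨a, b⟩ ⟨c, d⟩ h
  simp only [ofPair, Datum.cons.injEq] at h
  rw [ofFinset_injective h.1, ofFinset_injective h.2]

end Datum

/-- Programs. Each program acts on one tree; a tree counts as false if it is `nil` and as true
otherwise. -/
inductive Prog : Type
  /-- return the input -/
  | id : Prog
  /-- return `nil` -/
  | nil : Prog
  /-- return the left subtree of the input -/
  | hd : Prog
  /-- return the right subtree of the input -/
  | tl : Prog
  /-- test the two subtrees of the input for equality -/
  | eqTest : Prog
  /-- run both programs on the input and pair their results -/
  | cons : Prog → Prog → Prog
  /-- run the first program on the input, then the second on its result -/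
  | seq : Prog → Prog → Prog
  /-- `branch c p q`: if `c` returns true on the input, run `p` on it, otherwise `q` -/
  | branch : Prog → Prog → Prog → Prog
  /-- `loop c p`: while `c` returns true on the current tree, replace that tree by the result of
  `p` on it -/
  | loop : Prog → Prog → Prog

/-- `Run p x y t`: the program `p`, started on `x`, halts with the result `y` at cost `t`. -/
inductive Prog.Run : Prog → Datum → Datum → ℕ → Prop
  | id (x : Datum) : Run .id x x x.size
  | nil (x : Datum) : Run .nil x .nil x.size
  | hd (x : Datum) : Run .hd x x.hd x.size
  | tl (x : Datum) : Run .tl x x.tl x.size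
  | eqTest (x : Datum) : Run .eqTest x x.eqTest x.size
  | cons {p q : Prog} {x y z : Datum} {s t : ℕ} :
      Run p x y s → Run q x z t → Run (.cons p q) x (.cons y z) (x.size + s + t)
  | seq {p q : Prog} {x y z : Datum} {s t : ℕ} :
      Run p x y s → Run q y z t → Run (.seq p q) x z (x.size + s + t)
  | branch_true {c p q : Prog} {x b y : Datum} {s t : ℕ} :
      Run c x b s → b ≠ .nil → Run p x y t → Run (.branch c p q) x y (x.size + s + t)
  | branch_false {c p q : Prog} {x y : Datum} {s t : ℕ} :
      Run c x .nil s → Run q x y t → Run (.branch c p q) x y (x.size + s + t)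
  | loop_stop {c p : Prog} {x : Datum} {s : ℕ} :
      Run c x .nil s → Run (.loop c p) x x (x.size + s)
  | loop_step {c p : Prog} {x b y z : Datum} {s t u : ℕ} :
      Run c x b s → b ≠ .nil → Run p x y t → Run (.loop c p) y z u →
      Run (.loop c p) x z (x.size + s + t + u)

/-- Programs are deterministic, in their results and in their costs. -/
theorem Prog.Run.unique {p : Prog} {x y y' : Datum} {t t' : ℕ} (h : Run p x y t)
    (h' : Run p x y' t') : y = y' ∧ t = t' := by
  induction h generalizing y' t' with
  | id | nil | hd | tl | eqTest => cases h'; exact ⟨rfl, rfl⟩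
  | cons _ _ ih₁ ih₂ =>
    cases h' with
    | cons a b =>
      obtain ⟨rfl, rfl⟩ := ih₁ a
      obtain ⟨rfl, rfl⟩ := ih₂ b
      exact ⟨rfl, rfl⟩
  | seq _ _ ih₁ ih₂ =>
    cases h' with
    | seq a b =>
      obtain ⟨rfl, rfl⟩ := ih₁ a
      obtain ⟨rfl, rfl⟩ := ih₂ b
      exact ⟨rfl, rfl⟩
  | branch_true _ hb _ ih₁ ih₂ =>
    cases h' with
    | branch_true a _ c =>
      obtain ⟨-, rfl⟩ := ih₁ a
      obtain ⟨rfl, rfl⟩ := ih₂ c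
      exact ⟨rfl, rfl⟩
    | branch_false a c => exact absurd (ih₁ a).1 hb
  | branch_false _ _ ih₁ ih₂ =>
    cases h' with
    | branch_true a hb c => exact absurd (ih₁ a).1.symm hb
    | branch_false a c =>
      obtain ⟨-, rfl⟩ := ih₁ a
      obtain ⟨rfl, rfl⟩ := ih₂ c
      exact ⟨rfl, rfl⟩
  | loop_stop _ ih₁ =>
    cases h' with
    | loop_stop a =>
      obtain ⟨-, rfl⟩ := ih₁ a
      exact ⟨rfl, rfl⟩
    | loop_step a hb _ _ => exact absurd (ih₁ a).1.symm hb
  | loop_step _ hb _ _ ih₁ ih₂ ih₃ =>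
    cases h' with
    | loop_stop a => exact absurd (ih₁ a).1 hb
    | loop_step a _ c d =>
      obtain ⟨-, rfl⟩ := ih₁ a
      obtain ⟨rfl, rfl⟩ := ih₂ c
      obtain ⟨rfl, rfl⟩ := ih₃ d
      exact ⟨rfl, rfl⟩

/-! ## Minimization problems and approximation algorithms -/

/-- A minimization problem with a non-negative integer valued objective function, whose instances
and solutions are encoded injectively as trees. -/
structure MinimizationProblem where
  Instance : Type
  Solution : Type
  encodeInstance : Instance → Datum
  encodeInstance_injective : Function.Injective encodeInstance
  encodeSolution : Solution → Datum
  encodeSolution_injective : Function.Injective encodeSolution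
  /-- `Feasible x y`: `y` is a solution of the instance `x` -/
  Feasible : Instance → Solution → Prop
  exists_feasible : ∀ x, ∃ y, Feasible x y
  objective : Instance → Solution → ℕ

namespace MinimizationProblem

/-- The optimal value of an instance. -/
noncomputable def opt (P : MinimizationProblem) (x : P.Instance) : ℕ :=
  sInf {v | ∃ y, P.Feasible x y ∧ P.objective x y = v}

/-- `A` is an approximation algorithm for `P` with approximation factor `α`: it runs in time
polynomial in the size of the encoded instance and, for every instance `x`, returns a solution
of `x` whose objective value is at most `α x` times the optimal value. -/
def IsApproximationAlgorithm (P : MinimizationProblem) (α : P.Instance → ℝ) (A : Prog) : Prop :=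
  ∃ q : Polynomial ℕ, ∀ x : P.Instance, ∃ (y : P.Solution) (t : ℕ),
    A.Run (P.encodeInstance x) (P.encodeSolution y) t ∧
    t ≤ q.eval (P.encodeInstance x).size ∧
    P.Feasible x y ∧
    (P.objective x y : ℝ) ≤ α x * (P.opt x : ℝ)

end MinimizationProblem

theorem TwoComplex.list_injective : Function.Injective TwoComplex.list := by
  rintro ⟨⟨F, hF⟩, l, hl, h, hc⟩ ⟨⟨F', hF'⟩, l', hl', h', hc'⟩ (rfl : l = l')
  obtain rfl : F = F' := by
    ext σ
    exact (h σ).symm.trans (h' σ)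
  rfl

/-- With no reversed arcs, all arcs go from a simplex to one of smaller dimension. -/
theorem PreAbstractSimplicialComplex.isMorseMatching_empty {V : Type*}
    (K : PreAbstractSimplicialComplex V) : K.IsMorseMatching ∅ where
  isFacet := by simp
  disjoint := by simp
  acyclic := by
    have key : ∀ a b, Relation.TransGen (K.ReversedHasse ∅) a b → b.card < a.card := by
      intro a b h
      induction h with
      | single h => rcases h with ⟨⟨_, _, _, h⟩, _⟩ | ⟨_, h⟩ <;> simp_all
      | tail _ h ih => rcases h with ⟨⟨_, _, _, h⟩, _⟩ | ⟨_, h⟩ <;> [omega; simp_all]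
    exact fun σ h => lt_irrefl _ (key σ σ h)

/-- Min-Morse Matching on two-dimensional complexes: given a complex (as the list of its
simplices), find a Morse matching on it (as a list of pairs) with as few critical simplices as
possible. -/
noncomputable def minMorseMatching : MinimizationProblem where
  Instance := TwoComplex
  Solution := List (Finset ℕ × Finset ℕ)
  encodeInstance K := Datum.ofList (K.list.map Datum.ofFinset)
  encodeInstance_injective := fun _ _ h => TwoComplex.list_injective
    (Datum.ofFinset_injective.list_map (Datum.ofList_injective h))
  encodeSolution M := Datum.ofList (M.map Datum.ofPair)
  encodeSolution_injective := fun _ _ h =>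
    Datum.ofPair_injective.list_map (Datum.ofList_injective h)
  Feasible K M := K.IsMorseMatching {p | p ∈ M}
  exists_feasible K := ⟨[], by simpa using K.isMorseMatching_empty⟩
  objective K M := (K.criticalSimplices {p | p ∈ M}).ncard

/-! ## Polynomial time functions -/

/-! A Morse matching on a 2-complex splits into edge-triangle pairs and vertex-edge pairs, and
having few critical simplices means having many pairs (`ncard_criticalSimplices_add`).

Let `M` be any Morse matching, with `c` critical triangles among the `n` triangles. Once the
critical triangles are deleted, the rest can be removed by greedy collapses: acyclicity always
leaves a triangle with an edge in no other remaining triangle (`exists_filter_eq_singleton`), so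
greedy cannot get stuck. The critical triangles are unknown, but a small superset can be guessed.
Divide the positions in the list of triangles into their residue classes modulo some `g` of order
`log n` with `n < 2 ^ g`. There are only polynomially many unions of classes, and one of them
consists of the classes that meet the critical triangles. Deleting it costs at most `c * (n / g +
1)` triangles (`exists_mask_thin`). Trying all unions and keeping the longest greedy matching thus
loses a factor of order `n / log n`.

The edges left over form a graph, and greedy leaf removal matches all of its vertices but at most
one per component (`length_le_length_greedy_add`). Collapses do not disconnect the graph
(`isClosedUnder_of_unmatched`), and every component contains a critical vertex of `M`
(`exists_critical_mem`), so nothing is lost here in comparison with `M`.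

The output is acyclic because the order of the collapses yields a rank that drops along every arc
(`isMorseMatching_combine`). For the running time, all procedures are folds over lists whose
intermediate states have polynomial size (`PolyTime.foldl`). -/

theorem Polynomial.eval_mono_nat (q : Polynomial ℕ) : Monotone fun n => q.eval n := by
  intro a b h
  induction q using Polynomial.induction_on' with
  | add p q hp hq => simpa using add_le_add hp hq
  | monomial n c => simpa using Nat.mul_le_mul_left c (Nat.pow_le_pow_left h n)

/-! ### Runs with an upper bound on the cost -/

namespace Prog

/-- The program `p`, started on `x`, halts with the result `y` at cost at most `T`. -/
def RunsIn (p : Prog) (x y : Datum) (T : ℕ) : Prop := ∃ t, p.Run x y t ∧ t ≤ T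

variable {p q c : Prog} {x y z b : Datum} {S T U : ℕ}

theorem RunsIn.mono (h : RunsIn p x y S) (hST : S ≤ T) : RunsIn p x y T :=
  let ⟨t, h, ht⟩ := h
  ⟨t, h, ht.trans hST⟩

theorem runsIn_id : RunsIn .id x x x.size := ⟨_, .id x, le_rfl⟩

theorem runsIn_nil : RunsIn .nil x .nil x.size := ⟨_, .nil x, le_rfl⟩

theorem runsIn_hd : RunsIn .hd x x.hd x.size := ⟨_, .hd x, le_rfl⟩

theorem runsIn_tl : RunsIn .tl x x.tl x.size := ⟨_, .tl x, le_rfl⟩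

theorem runsIn_eqTest : RunsIn .eqTest x x.eqTest x.size := ⟨_, .eqTest x, le_rfl⟩

theorem RunsIn.cons (h : RunsIn p x y S) (h' : RunsIn q x z T) :
    RunsIn (.cons p q) x (.cons y z) (x.size + S + T) :=
  let ⟨_, h, _⟩ := h
  let ⟨_, h', _⟩ := h'
  ⟨_, .cons h h', by omega⟩

theorem RunsIn.seq (h : RunsIn p x y S) (h' : RunsIn q y z T) :
    RunsIn (.seq p q) x z (x.size + S + T) :=
  let ⟨_, h, _⟩ := h
  let ⟨_, h', _⟩ := h'
  ⟨_, .seq h h', by omega⟩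

theorem RunsIn.branch_true (hc : RunsIn c x b S) (hb : b ≠ .nil) (h : RunsIn p x y T) :
    RunsIn (.branch c p q) x y (x.size + S + T) :=
  let ⟨_, hc, _⟩ := hc
  let ⟨_, h, _⟩ := h
  ⟨_, .branch_true hc hb h, by omega⟩

theorem RunsIn.branch_false (hc : RunsIn c x .nil S) (h : RunsIn q x y T) :
    RunsIn (.branch c p q) x y (x.size + S + T) :=
  let ⟨_, hc, _⟩ := hc
  let ⟨_, h, _⟩ := h
  ⟨_, .branch_false hc h, by omega⟩

theorem RunsIn.loop_stop (hc : RunsIn c x .nil S) : RunsIn (.loop c p) x x (x.size + S) :=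
  let ⟨_, hc, _⟩ := hc
  ⟨_, Prog.Run.loop_stop hc, by omega⟩

theorem RunsIn.loop_step (hc : RunsIn c x b S) (hb : b ≠ .nil) (h : RunsIn p x y T)
    (h' : RunsIn (.loop c p) y z U) : RunsIn (.loop c p) x z (x.size + S + T + U) :=
  let ⟨_, hc, _⟩ := hc
  let ⟨_, h, _⟩ := h
  let ⟨_, h', _⟩ := h'
  ⟨_, .loop_step hc hb h h', by omega⟩

/-- A result is paid for when it is built, so time bounds double as size bounds. This is what makes
compositions of polynomial-time programs polynomial. -/
theorem Run.size_le {t : ℕ} (h : Run p x y t) : y.size ≤ t := by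
  induction h with
  | id | nil => cases ‹Datum› <;> simp [Datum.size]
  | hd x | tl x => cases x <;> (simp only [Datum.size, Datum.hd, Datum.tl]; omega)
  | eqTest x =>
    cases x with
    | nil => simp [Datum.eqTest]
    | cons a b =>
      have ha : 1 ≤ a.size := by cases a <;> simp [Datum.size]
      have hb : 1 ≤ b.size := by cases b <;> simp [Datum.size]
      by_cases h : a = b
      · simp only [Datum.size, Datum.eqTest, Datum.ofBool, h, decide_true]
        omega
      · simp only [Datum.size, Datum.eqTest, Datum.ofBool, h, decide_false]
        omega
  | @cons _ _ x =>
    have hx : 1 ≤ x.size := by cases x <;> simp [Datum.size]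
    simp only [Datum.size]
    omega
  | _ => omega

theorem RunsIn.size_le (h : RunsIn p x y T) : y.size ≤ T :=
  let ⟨_, h, ht⟩ := h
  h.size_le.trans ht

end Prog

/-! ### Encodings of data and their sizes -/

open Prog

theorem Datum.one_le_size (x : Datum) : 1 ≤ x.size := by cases x <;> simp [Datum.size]

/-- Types whose elements are represented by trees. -/
class Enc (α : Type) where
  enc : α → Datum
  enc_injective : Function.Injective enc

open Enc

/-- The size of the tree that represents `a`. -/
def encSize {α : Type} [Enc α] (a : α) : ℕ := (enc a).size

instance : Enc Bool := ⟨Datum.ofBool, Datum.ofBool_injective⟩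

instance : Enc ℕ := ⟨Datum.ofNat, Datum.ofNat_injective⟩

instance : Enc (Finset ℕ) := ⟨Datum.ofFinset, Datum.ofFinset_injective⟩

instance {α β : Type} [Enc α] [Enc β] : Enc (α × β) where
  enc p := .cons (enc p.1) (enc p.2)
  enc_injective := by
    rintro ⟨a, b⟩ ⟨c, d⟩ h
    simp only [Datum.cons.injEq] at h
    rw [enc_injective h.1, enc_injective h.2]

instance {α : Type} [Enc α] : Enc (List α) where
  enc l := .ofList (l.map enc)
  enc_injective _ _ h := enc_injective.list_map (Datum.ofList_injective h)

section

variable {α β γ δ : Type} [Enc α] [Enc β] [Enc γ] [Enc δ]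

theorem enc_pair (a : α) (b : β) : enc (a, b) = .cons (enc a) (enc b) := rfl

theorem enc_cons (a : α) (l : List α) : enc (a :: l) = .cons (enc a) (enc l) := rfl

theorem one_le_encSize (a : α) : 1 ≤ encSize a := Datum.one_le_size _

theorem encSize_pair (a : α) (b : β) : encSize (a, b) = encSize a + encSize b + 1 := rfl

theorem encSize_nil : encSize ([] : List α) = 1 := rfl

theorem encSize_cons (a : α) (l : List α) : encSize (a :: l) = encSize a + encSize l + 1 := rfl

theorem encSize_append (l₁ l₂ : List α) : encSize (l₁ ++ l₂) + 1 = encSize l₁ + encSize l₂ := by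
  induction l₁ with
  | nil => simp [encSize_nil, add_comm]
  | cons a l ih => simp only [List.cons_append, encSize_cons]; omega

theorem length_lt_encSize (l : List α) : l.length < encSize l := by
  induction l with
  | nil => simp [encSize_nil]
  | cons a l ih => simp only [List.length_cons, encSize_cons]; omega

theorem encSize_le_of_sublist {l₁ l₂ : List α} (h : l₁.Sublist l₂) :
    encSize l₁ ≤ encSize l₂ := by
  induction h with
  | slnil => rfl
  | cons _ _ ih => simp only [encSize_cons]; omega
  | cons_cons _ _ ih => simp only [encSize_cons]; omega

theorem encSize_lt_of_mem {l : List α} {a : α} (h : a ∈ l) : encSize a < encSize l := by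
  induction l with
  | nil => simp at h
  | cons b l ih =>
    rw [encSize_cons]
    rcases List.mem_cons.1 h with rfl | h
    · have := one_le_encSize l; omega
    · have := ih h; omega

theorem encSize_reverse (l : List α) : encSize l.reverse = encSize l := by
  induction l with
  | nil => rfl
  | cons a l ih =>
    have := encSize_append l.reverse [a]
    rw [List.reverse_cons]
    simp only [encSize_cons, encSize_nil] at *
    omega

theorem encSize_list_le {l : List α} {B : ℕ} (h : ∀ a ∈ l, encSize a ≤ B) :
    encSize l ≤ l.length * (B + 1) + 1 := by
  induction l with
  | nil => simp [encSize_nil]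
  | cons a l ih =>
    have h₁ := h a (by simp)
    have h₂ := ih fun b hb => h b (by simp [hb])
    rw [encSize_cons, List.length_cons, Nat.succ_mul]
    omega

/-- The function `f` is computed by a program in polynomial time. -/
def PolyTime (f : α → β) : Prop :=
  ∃ (p : Prog) (q : Polynomial ℕ), ∀ a, RunsIn p (enc a) (enc (f a)) (q.eval (encSize a))

/-! ### Closure properties of polynomial-time functions -/

namespace PolyTime

theorem size_le {f : α → β} (hf : PolyTime f) :
    ∃ q : Polynomial ℕ, ∀ a, encSize (f a) ≤ q.eval (encSize a) :=
  let ⟨_, q, h⟩ := hf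
  ⟨q, fun a => (h a).size_le⟩

/-- A change of representation that does not alter the tree. -/
theorem of_enc_eq {f : α → β} (h : ∀ a, enc (f a) = enc a) : PolyTime f :=
  ⟨.id, .X, fun a => by simpa [h, encSize] using runsIn_id⟩

theorem id : PolyTime fun a : α => a := of_enc_eq fun _ => rfl

theorem comp {g : β → γ} {f : α → β} (hg : PolyTime g) (hf : PolyTime f) :
    PolyTime fun a => g (f a) := by
  obtain ⟨p, q, h⟩ := hf
  obtain ⟨p', q', h'⟩ := hg
  refine ⟨.seq p p', .X + q + q'.comp q, fun a => ((h a).seq (h' (f a))).mono ?_⟩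
  have := q'.eval_mono_nat (h a).size_le
  simp only [Polynomial.eval_add, Polynomial.eval_X, Polynomial.eval_comp]
  exact Nat.add_le_add_left this _

theorem pair {f : α → β} {g : α → γ} (hf : PolyTime f) (hg : PolyTime g) :
    PolyTime fun a => (f a, g a) := by
  obtain ⟨p, q, h⟩ := hf
  obtain ⟨p', q', h'⟩ := hg
  refine ⟨.cons p p', .X + q + q', fun a => ((h a).cons (h' a)).mono ?_⟩
  simp [encSize]

theorem fst {f : α → β × γ} (hf : PolyTime f) : PolyTime fun a => (f a).1 :=
  comp (g := Prod.fst) ⟨.hd, .X, fun x => (runsIn_hd (x := enc x)).mono (by simp [encSize])⟩ hf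

theorem snd {f : α → β × γ} (hf : PolyTime f) : PolyTime fun a => (f a).2 :=
  comp (g := Prod.snd) ⟨.tl, .X, fun x => (runsIn_tl (x := enc x)).mono (by simp [encSize])⟩ hf

theorem nil : PolyTime fun _ : α => ([] : List β) :=
  ⟨.nil, .X, fun _ => runsIn_nil.mono (by simp [encSize])⟩

theorem cons {f : α → β} {g : α → List β} (hf : PolyTime f) (hg : PolyTime g) :
    PolyTime fun a => f a :: g a :=
  comp (g := fun x : β × List β => x.1 :: x.2) (of_enc_eq fun _ => rfl) (hf.pair hg)

theorem false : PolyTime fun _ : α => Bool.false :=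
  ⟨.nil, .X, fun _ => runsIn_nil.mono (by simp [encSize])⟩

theorem true : PolyTime fun _ : α => Bool.true := by
  refine ⟨.cons .nil .nil, .X + .X + .X, fun a => ?_⟩
  exact (runsIn_nil.cons runsIn_nil).mono (by simp [encSize])

theorem cond {c : α → Bool} {f g : α → β} (hc : PolyTime c) (hf : PolyTime f)
    (hg : PolyTime g) : PolyTime fun a => bif c a then f a else g a := by
  obtain ⟨p, q, h⟩ := hf
  obtain ⟨p', q', h'⟩ := hg
  obtain ⟨r, s, hr⟩ := hc
  refine ⟨.branch r p p', .X + s + (q + q'), fun a => ?_⟩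
  have hr := hr a
  cases hca : c a <;> rw [hca] at hr <;> simp only [hca, cond_true, cond_false]
  · refine (hr.branch_false (h' a)).mono ?_
    simp [encSize]
  · refine (hr.branch_true (by simp [enc, Datum.ofBool]) (h a)).mono ?_
    simp [encSize]

/-- Encodings are injective, so the equality test on trees decides equality of the encoded values.
-/
theorem decide_eq [DecidableEq β] {f g : α → β} (hf : PolyTime f) (hg : PolyTime g) :
    PolyTime fun a => decide (f a = g a) := by
  refine comp (g := fun x : β × β => decide (x.1 = x.2)) ⟨.eqTest, .X, ?_⟩ (hf.pair hg)
  rintro ⟨x, y⟩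
  have : enc (decide (x = y)) = (enc (x, y)).eqTest := by
    simp [enc, Datum.eqTest, Datum.ofBool, enc_injective.eq_iff]
  simp only [this, Polynomial.eval_X, encSize]
  exact runsIn_eqTest

theorem not {c : α → Bool} (hc : PolyTime c) : PolyTime fun a => !c a := by
  convert hc.cond false true using 2 with a
  cases c a <;> rfl

theorem and {c d : α → Bool} (hc : PolyTime c) (hd : PolyTime d) :
    PolyTime fun a => c a && d a := by
  convert hc.cond hd false using 2 with a
  cases c a <;> rfl

theorem or {c d : α → Bool} (hc : PolyTime c) (hd : PolyTime d) :
    PolyTime fun a => c a || d a := by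
  convert hc.cond true hd using 2 with a
  cases c a <;> rfl

theorem listCase {l : α → List β} {f : α → γ} {g : α → β → List β → γ} (hl : PolyTime l)
    (hf : PolyTime f) (hg : PolyTime fun x : α × β × List β => g x.1 x.2.1 x.2.2) :
    PolyTime fun a => match l a with
      | [] => f a
      | b :: l' => g a b l' := by
  refine comp (g := fun x : α × List β => match x.2 with
      | [] => f x.1
      | b :: l' => g x.1 b l') ?_ (id.pair hl)
  obtain ⟨p, q, h⟩ := hf.comp (fst id : PolyTime fun x : α × List β => x.1)
  obtain ⟨p', q', h'⟩ := hg
  -- The right subtree of the code of `(a, l)` is the code of `l`, which is `nil` exactly for the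
  -- empty list. The codes of `(a, b :: l')` and `(a, b, l')` are the same tree, so nothing has to
  -- be rearranged.
  refine ⟨.branch .tl p' p, .X + .X + (q + q'), ?_⟩
  rintro ⟨a, _ | ⟨b, l'⟩⟩
  · refine (runsIn_tl.branch_false (h (a, []))).mono ?_
    simp [encSize]
  · refine (runsIn_tl.branch_true (by simp [enc_pair, Datum.tl])
      (h' (a, b, l'))).mono ?_
    simp only [Polynomial.eval_add, Polynomial.eval_X]
    change encSize (a, b :: l') + encSize (a, b :: l') + q'.eval (encSize (a, b :: l')) ≤ _
    omega

theorem tail {l : α → List β} (hl : PolyTime l) : PolyTime fun a => (l a).tail :=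
  comp (g := List.tail) ⟨.tl, .X, fun l => by
    have : enc l.tail = (enc l).tl := by cases l <;> rfl
    simpa [encSize, this] using runsIn_tl⟩ hl

theorem isEmpty {l : α → List β} (hl : PolyTime l) : PolyTime fun a => (l a).isEmpty := by
  convert listCase hl true (g := fun _ _ _ => Bool.false) false using 2 with a
  cases l a <;> rfl

/-- Folds are computed in polynomial time if their intermediate results stay small. -/
theorem foldl {f : α → β → γ → β} {b : α → β} {l : α → List γ}
    (hf : PolyTime fun x : α × β × γ => f x.1 x.2.1 x.2.2) (hb : PolyTime b) (hl : PolyTime l)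
    (Q : Polynomial ℕ)
    (hQ : ∀ a l', l' <+: l a → encSize (l'.foldl (f a) (b a)) ≤ Q.eval (encSize a)) :
    PolyTime fun a => (l a).foldl (f a) (b a) := by
  obtain ⟨r, s, hrun⟩ := id.pair (hb.pair hl)
  obtain ⟨p, q, h⟩ := hf
  obtain ⟨ql, hql⟩ := hl.size_le
  -- `B` bounds the loop state, which consists of the input, the accumulator, the remaining list and
  -- two nodes joining them. In `W`, the term `40 * B` is a generous allowance for the bookkeeping
  -- of one round, and `q.comp B` pays for the call of `p`.
  let B : Polynomial ℕ := .X + Q + ql + 2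
  let W : Polynomial ℕ := 40 * B + q.comp B
  let step : Prog := .cons .hd (.cons
    (.seq (.cons .hd (.cons (.seq .tl .hd) (.seq .tl (.seq .tl .hd)))) p)
    (.seq .tl (.seq .tl .tl)))
  let c : Prog := .seq .tl .tl
  have key : ∀ a l₁ l₂, l₁ ++ l₂ = l a →
      RunsIn (.loop c step) (enc (a, l₁.foldl (f a) (b a), l₂))
        (enc (a, (l a).foldl (f a) (b a), ([] : List γ)))
        ((l₂.length + 1) * W.eval (encSize a)) := by
    intro a l₁ l₂ hl₂
    have hB : ∀ l₁ l₂, l₁ ++ l₂ = l a →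
        (enc (a, l₁.foldl (f a) (b a), l₂)).size ≤ B.eval (encSize a) := by
      intro l₁ l₂ h
      have h₁ := hQ a l₁ ⟨l₂, h⟩
      have h₂ := (encSize_le_of_sublist (h ▸ List.sublist_append_right l₁ l₂)).trans (hql a)
      have h₃ : (enc (a, l₁.foldl (f a) (b a), l₂)).size =
        encSize a + (encSize (l₁.foldl (f a) (b a)) + encSize l₂ + 1) + 1 := rfl
      simp only [B, Polynomial.eval_add, Polynomial.eval_X, Polynomial.eval_ofNat]
      omega
    have hW : W.eval (encSize a) = 40 * B.eval (encSize a) + q.eval (B.eval (encSize a)) := by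
      simp [W]
    induction l₂ generalizing l₁ with
    | nil =>
      have hB := hB _ _ hl₂
      rw [List.append_nil] at hl₂
      subst hl₂
      refine (RunsIn.loop_stop (runsIn_tl.seq runsIn_tl)).mono ?_
      simp only [enc_pair, Datum.tl, Datum.size] at hB ⊢
      rw [hW]
      simp only [List.length_nil]
      omega
    | cons z l₂ ih =>
      have hB₁ := hB _ _ hl₂
      have hl₃ : (l₁ ++ [z]) ++ l₂ = l a := by simpa using hl₂
      have ih := ih (l₁ ++ [z]) hl₃
      rw [List.foldl_append, List.foldl_cons, List.foldl_nil] at ih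
      have hp := h (a, l₁.foldl (f a) (b a), z)
      have hs : encSize (a, l₁.foldl (f a) (b a), z) ≤ B.eval (encSize a) := by
        refine le_trans ?_ hB₁
        simp only [encSize, enc_pair, enc_cons, Datum.size]
        omega
      have hp := hp.mono (q.eval_mono_nat hs)
      refine (RunsIn.loop_step (runsIn_tl.seq runsIn_tl) ?_
        (y := enc (a, f a (l₁.foldl (f a) (b a)) z, l₂))
        (RunsIn.cons runsIn_hd (RunsIn.cons (RunsIn.seq (RunsIn.cons runsIn_hd
          (RunsIn.cons (runsIn_tl.seq runsIn_hd) (runsIn_tl.seq (runsIn_tl.seq runsIn_hd)))) hp)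
          (runsIn_tl.seq (runsIn_tl.seq runsIn_tl)))) ih).mono ?_
      · simp [enc_pair, enc_cons, Datum.tl]
      · rw [List.length_cons, Nat.succ_mul (l₂.length + 1)]
        simp only [enc_pair, enc_cons, Datum.tl, Datum.size] at hB₁ ⊢
        generalize (l₂.length + 1) * W.eval (encSize a) = w
        rw [hW]
        omega
  -- The last summand pays for extracting the accumulator: this is charged at most three times the
  -- size of the final state, and that size is bounded by the cost of the loop.
  refine ⟨.seq r (.seq (.loop c step) (.seq .tl .hd)),
    .X + s + (s + (ql + 1) * W + 3 * ((ql + 1) * W)), fun a => ?_⟩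
  have hk := key a [] (l a) rfl
  have hr := hrun a
  have h₁ : (enc (a, b a, l a)).size ≤ s.eval (encSize a) := hr.size_le
  have h₂ := hk.size_le
  have h₃ := length_lt_encSize (l a)
  have h₄ := Nat.mul_le_mul_right (W.eval (encSize a)) (h₃.le.trans (hql a))
  refine (hr.seq (hk.seq (runsIn_tl.seq runsIn_hd))).mono ?_
  rw [Nat.succ_mul] at h₂ ⊢
  simp only [enc_pair, Datum.tl, Datum.size, Polynomial.eval_add, Polynomial.eval_mul,
    Polynomial.eval_X, Polynomial.eval_ofNat, add_mul, one_mul] at h₁ h₂ ⊢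
  change encSize a + _ + _ ≤ _
  simp only [List.foldl_nil]
  omega

end PolyTime
end

/-! ### List operations in polynomial time -/

namespace PolyTime

variable {α β γ δ : Type} [Enc α] [Enc β] [Enc γ] [Enc δ]

theorem reverse {l : α → List β} (hl : PolyTime l) : PolyTime fun a => (l a).reverse := by
  have key : ∀ l : List β, l.foldl (fun acc b => b :: acc) [] = l.reverse := by simp
  obtain ⟨q, hq⟩ := hl.size_le
  convert foldl (f := fun _ acc b => b :: acc) (b := fun _ => [])
    (cons (snd (snd id)) (fst (snd id))) nil hl q ?_ using 2 with a
  · exact (key _).symm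
  · intro a l' h
    rw [key, encSize_reverse]
    exact (encSize_le_of_sublist h.sublist).trans (hq a)

theorem append {l₁ l₂ : α → List β} (h₁ : PolyTime l₁) (h₂ : PolyTime l₂) :
    PolyTime fun a => l₁ a ++ l₂ a := by
  have key : ∀ l l' : List β, l.foldl (fun acc b => b :: acc) l' = l.reverse ++ l' := by simp
  obtain ⟨q₁, hq₁⟩ := h₁.reverse.size_le
  obtain ⟨q₂, hq₂⟩ := h₂.size_le
  convert foldl (f := fun _ acc b => b :: acc)
    (cons (snd (snd id)) (fst (snd id))) h₂ h₁.reverse (q₁ + q₂) ?_ using 2 with a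
  · rw [key, List.reverse_reverse]
  · intro a l' h
    have h₃ := encSize_append l'.reverse (l₂ a)
    have h₄ := (encSize_le_of_sublist h.sublist).trans (hq₁ a)
    have h₅ := hq₂ a
    rw [encSize_reverse] at h₃
    rw [key, Polynomial.eval_add]
    omega

theorem filter {p : α → β → Bool} {l : α → List β} (hp : PolyTime fun x : α × β => p x.1 x.2)
    (hl : PolyTime l) : PolyTime fun a => (l a).filter (p a) := by
  have key : ∀ (p : β → Bool) (l : List β),
      l.foldl (fun acc b => bif p b then b :: acc else acc) [] = (l.filter p).reverse := by
    intro p l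
    induction l using List.reverseRecOn with
    | nil => rfl
    | append_singleton l b ih => cases h : p b <;> simp [ih, h]
  obtain ⟨q, hq⟩ := hl.size_le
  convert reverse (foldl (f := fun a acc b => bif p a b then b :: acc else acc)
    (b := fun _ => []) (cond (hp.comp (pair (fst id) (snd (snd id))))
      (cons (snd (snd id)) (fst (snd id))) (fst (snd id))) nil hl q ?_) using 2 with a
  · rw [key, List.reverse_reverse]
  · intro a l' h
    rw [key, encSize_reverse]
    exact (encSize_le_of_sublist (List.filter_sublist.trans h.sublist)).trans (hq a)

theorem map {f : α → β → γ} {l : α → List β} (hf : PolyTime fun x : α × β => f x.1 x.2)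
    (hl : PolyTime l) : PolyTime fun a => (l a).map (f a) := by
  have key : ∀ (f : β → γ) (l : List β),
      l.foldl (fun acc b => f b :: acc) [] = (l.map f).reverse := by
    intro f l
    induction l using List.reverseRecOn with
    | nil => rfl
    | append_singleton l b ih => simp
  obtain ⟨q, hq⟩ := hl.size_le
  obtain ⟨r, hr⟩ := hf.size_le
  convert reverse (foldl (f := fun a acc b => f a b :: acc)
    (b := fun _ => []) (cons (hf.comp (pair (fst id) (snd (snd id)))) (fst (snd id))) nil hl
      (q * (r.comp (.X + q + 1) + 1) + 1) ?_) using 2 with a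
  · rw [key, List.reverse_reverse]
  · intro a l' h
    rw [key, encSize_reverse]
    -- The list has at most `q` entries, each of them computed from a pair `(a, b)` of size at most
    -- `encSize a + q + 1`.
    refine (encSize_list_le (B := r.eval (encSize a + q.eval (encSize a) + 1)) ?_).trans ?_
    · intro c hc
      obtain ⟨b, hb, rfl⟩ := List.mem_map.1 hc
      refine (hr (a, b)).trans (r.eval_mono_nat ?_)
      have h₁ := encSize_lt_of_mem (h.subset hb)
      have h₂ := hq a
      rw [encSize_pair]
      omega
    · have h₁ := h.length_le
      have h₂ := length_lt_encSize (l a)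
      have h₃ := hq a
      simp only [List.length_map, Polynomial.eval_add, Polynomial.eval_mul, Polynomial.eval_comp,
        Polynomial.eval_X, Polynomial.eval_one]
      gcongr
      omega

end PolyTime

/-! ## The algorithm -/

/-- Whether a list has exactly one entry. -/
def List.isSingleton {α : Type} (l : List α) : Bool := !l.isEmpty && l.tail.isEmpty

/-- Whether the first list is not longer than the second. -/
def leLength {α β : Type} (l₁ : List α) (l₂ : List β) : Bool :=
  (l₂.foldl (fun l _ => l.tail) l₁).isEmpty

section Greedy

variable {α : Type} [DecidableEq α] (adj : α → α → Bool)

/-- If some entry `e` of `E` has exactly one neighbour `t` in the list `s.1`, then match `e` with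
`t`, otherwise give up the first entry of `s.1`. -/
def greedyStep (E : List α) (s : List α × List (α × α)) : List α × List (α × α) :=
  match E.filter (fun e => (s.1.filter (adj e)).isSingleton) with
  | [] => (s.1.tail, s.2)
  | e :: _ =>
    match s.1.filter (adj e) with
    | [] => (s.1.tail, s.2)
    | t :: _ => (s.1.filter (fun u => !decide (u = t)), (e, t) :: s.2)

/-- The pairs formed by greedily matching entries of `E` with their only remaining neighbours in
`S`, the last pair first. -/
def greedy (E S : List α) : List (α × α) :=
  (S.foldl (fun s _ => greedyStep adj E s) (S, [])).2

/-- One step of `thin`. -/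
def thinStep (s : List Bool × List α) (t : α) : List Bool × List α :=
  match s.1 with
  | [] => s
  | b :: m => (m ++ [b], bif b then s.2 else t :: s.2)

/-- Remove from `T` the entries at the positions marked by the periodic repetition of `m`. -/
def thin (m : List Bool) (T : List α) : List α := (T.foldl thinStep (m, [])).2

/-- All lists of truth values of length `g`, where `g` is about the logarithm of the length
of `T`. -/
def masks (T : List α) : List (List Bool) :=
  T.foldl (fun acc _ => bif leLength acc T then
    acc.map (fun m => true :: m) ++ acc.map (fun m => false :: m) else acc) [[]]

/-- The longest greedy matching of entries of `E` with a list obtained by thinning out `T`. -/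
def bestGreedy (E T : List α) : List (α × α) :=
  (masks T).foldl (fun best m => bif leLength (greedy adj E (thin m T)) best then best
    else greedy adj E (thin m T)) []

/-- The entries of `E` that are not the first component of a pair in `P`. -/
def unmatched (E : List α) (P : List (α × α)) : List α :=
  E.filter fun e => (P.filter fun p => decide (p.1 = e)).isEmpty

end Greedy

/-- Whether one of the sets contains the other. -/
def comparable (s t : Finset ℕ) : Bool := decide (s ⊆ t) || decide (t ⊆ s)

/-- The pairs of edges and triangles that are matched by the algorithm. -/
def upperPairs (L : List (Finset ℕ)) : List (Finset ℕ × Finset ℕ) :=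
  bestGreedy comparable (L.filter fun s => decide (s.card = 2))
    (L.filter fun s => decide (s.card = 3))

/-- The pairs of edges and vertices that are matched by the algorithm. -/
def lowerPairs (L : List (Finset ℕ)) : List (Finset ℕ × Finset ℕ) :=
  greedy comparable (unmatched (L.filter fun s => decide (s.card = 2)) (upperPairs L))
    (L.filter fun s => decide (s.card = 1))

/-- The Morse matching found by the algorithm. -/
def approxMatching (L : List (Finset ℕ)) : List (Finset ℕ × Finset ℕ) :=
  upperPairs L ++ (lowerPairs L).map fun p => (p.2, p.1)

theorem List.isSingleton_iff {α : Type} {l : List α} : l.isSingleton ↔ ∃ a, l = [a] := by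
  rcases l with _ | ⟨a, _ | ⟨b, l⟩⟩ <;> simp [List.isSingleton]

theorem foldl_tail {α β : Type} (l₁ : List α) (l₂ : List β) :
    l₂.foldl (fun l _ => l.tail) l₁ = l₁.drop l₂.length := by
  induction l₂ generalizing l₁ with
  | nil => rfl
  | cons b l₂ ih => simp [ih]

theorem leLength_iff {α β : Type} {l₁ : List α} {l₂ : List β} :
    leLength l₁ l₂ ↔ l₁.length ≤ l₂.length := by
  simp [leLength, foldl_tail]

/-! ### Greedy matchings and collapse sequences -/

section Greedy

variable {α : Type} [DecidableEq α] {adj : α → α → Bool} {E S : List α}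

theorem greedyStep_cases (s : List α × List (α × α)) :
    (∃ e ∈ E, ∃ t, s.1.filter (adj e) = [t] ∧
      greedyStep adj E s = (s.1.filter (fun u => !decide (u = t)), (e, t) :: s.2)) ∨
    ((∀ e ∈ E, ∀ t, s.1.filter (adj e) ≠ [t]) ∧ greedyStep adj E s = (s.1.tail, s.2)) := by
  unfold greedyStep
  rcases h : E.filter (fun e => (s.1.filter (adj e)).isSingleton) with _ | ⟨e, l⟩
  · refine .inr ⟨fun e he t ht => ?_, rfl⟩
    rw [List.filter_eq_nil_iff] at h
    exact h e he (List.isSingleton_iff.2 ⟨t, ht⟩)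
  · have he : e ∈ E.filter (fun e => (s.1.filter (adj e)).isSingleton) := by simp [h]
    obtain ⟨he, hs⟩ := List.mem_filter.1 he
    obtain ⟨t, ht⟩ := List.isSingleton_iff.1 hs
    exact .inl ⟨e, he, t, ht, by simp [ht]⟩

theorem length_greedyStep_le (s : List α × List (α × α)) :
    (greedyStep adj E s).1.length ≤ s.1.length - 1 := by
  rcases greedyStep_cases (adj := adj) (E := E) s with ⟨e, _, t, ht, h⟩ | ⟨_, h⟩
  · have ht : t ∈ s.1.filter (adj e) := by simp [ht]
    rw [h]
    have : (s.1.filter (fun u => !decide (u = t))).length < s.1.length :=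
      List.length_filter_lt_length_iff_exists.2 ⟨t, (List.mem_filter.1 ht).1, by simp⟩
    dsimp only
    omega
  · simp [h]

/-- A property of the states of the greedy algorithm that holds initially and is preserved holds
for a final state, in which no entries are left. -/
theorem greedy_induction (motive : List α → List (α × α) → Prop) (init : motive S [])
    (step : ∀ s, motive s.1 s.2 →
      motive (greedyStep adj E s).1 (greedyStep adj E s).2) :
    motive [] (greedy adj E S) := by
  have key : ∀ (l : List α) (s : List α × List (α × α)), motive s.1 s.2 →
      motive (l.foldl (fun s _ => greedyStep adj E s) s).1
        (l.foldl (fun s _ => greedyStep adj E s) s).2 ∧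
      (l.foldl (fun s _ => greedyStep adj E s) s).1.length ≤ s.1.length - l.length := by
    intro l
    induction l with
    | nil => exact fun s hs => ⟨hs, by simp⟩
    | cons a l ih =>
      intro s hs
      have h₁ := ih _ (step s hs)
      have h₂ := length_greedyStep_le (adj := adj) (E := E) s
      refine ⟨h₁.1, h₁.2.trans ?_⟩
      rw [List.length_cons]
      omega
  obtain ⟨h₁, h₂⟩ := key S (S, []) init
  -- Each round removes at least one entry, so `S.length` rounds leave none.
  rw [Nat.sub_self] at h₂
  rw [List.eq_nil_of_length_eq_zero (Nat.le_zero.1 h₂)] at h₁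
  exact h₁

/-- Pairs of adjacent elements, in an order such that the first component of a pair is not
adjacent to the second components of the pairs that precede it. -/
structure IsCollapseSeq (adj : α → α → Bool) (P : List (α × α)) : Prop where
  adj_of_mem : ∀ p ∈ P, adj p.1 p.2
  pairwise : P.Pairwise fun p q => ¬ adj q.1 p.2

/-- When `e` is matched, its partner is its only remaining neighbour. From then on no remaining
entry is adjacent to `e`, and hence neither is the second component of any pair formed later; such
pairs precede `e` in the list. -/
theorem isCollapseSeq_greedy : IsCollapseSeq adj (greedy adj E S) ∧
    ∀ p ∈ greedy adj E S, p.1 ∈ E ∧ p.2 ∈ S := by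
  suffices h : (∀ u ∈ ([] : List α), u ∈ S ∧ ∀ p ∈ greedy adj E S, ¬ adj p.1 u) ∧
      IsCollapseSeq adj (greedy adj E S) ∧ ∀ p ∈ greedy adj E S, p.1 ∈ E ∧ p.2 ∈ S from h.2
  refine greedy_induction (fun S' P => (∀ u ∈ S', u ∈ S ∧ ∀ p ∈ P, ¬ adj p.1 u) ∧
    IsCollapseSeq adj P ∧ ∀ p ∈ P, p.1 ∈ E ∧ p.2 ∈ S) ⟨by simp, ⟨by simp, by simp⟩, by simp⟩ ?_
  rintro s ⟨h₁, h₂, h₃⟩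
  rcases greedyStep_cases (adj := adj) (E := E) s with ⟨e, he, t, ht, h⟩ | ⟨_, h⟩
  · rw [h]
    have hts : t ∈ s.1.filter (adj e) := by simp [ht]
    obtain ⟨hts, hta⟩ := List.mem_filter.1 hts
    refine ⟨fun u hu => ?_, ⟨?_, ?_⟩, ?_⟩
    · simp only [List.mem_filter, Bool.not_eq_true', decide_eq_false_iff_not] at hu
      refine ⟨(h₁ u hu.1).1, fun p hp => ?_⟩
      rcases List.mem_cons.1 hp with rfl | hp
      · intro hpu
        have : u ∈ s.1.filter (adj e) := List.mem_filter.2 ⟨hu.1, hpu⟩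
        rw [ht, List.mem_singleton] at this
        exact hu.2 this
      · exact (h₁ u hu.1).2 p hp
    · intro p hp
      rcases List.mem_cons.1 hp with rfl | hp
      · exact hta
      · exact h₂.adj_of_mem p hp
    · exact List.pairwise_cons.2 ⟨fun q hq => (h₁ t hts).2 q hq, h₂.pairwise⟩
    · intro p hp
      rcases List.mem_cons.1 hp with rfl | hp
      · exact ⟨he, (h₁ t hts).1⟩
      · exact h₃ p hp
  · rw [h]
    exact ⟨fun u hu => h₁ u (List.mem_of_mem_tail hu), h₂, h₃⟩

theorem length_filter_ne {l : List α} (hl : l.Nodup) {t : α} (ht : t ∈ l) :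
    (l.filter (fun u => !decide (u = t))).length + 1 = l.length := by
  have : l.filter (fun u => !decide (u = t)) = l.erase t := by
    rw [hl.erase_eq_filter]
    congr 1
  rw [this, List.length_erase_add_one ht]

/-- The greedy algorithm matches all of `S` if it cannot get stuck. -/
theorem length_greedy_of_forall (hS : S.Nodup)
    (h : ∀ S' : List α, S'.Sublist S → S' ≠ [] → ∃ e ∈ E, ∃ t, S'.filter (adj e) = [t]) :
    (greedy adj E S).length = S.length := by
  suffices h : ([] : List α).Sublist S ∧ ([] : List α).length + (greedy adj E S).length = S.length
    by simpa using h.2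
  refine greedy_induction (fun S' P => S'.Sublist S ∧ S'.length + P.length = S.length)
    ⟨.refl _, rfl⟩ ?_
  rintro s ⟨h₁, h₂⟩
  rcases greedyStep_cases (adj := adj) (E := E) s with ⟨e, he, t, ht, hs⟩ | ⟨hn, hs⟩
  · rw [hs]
    have hts : t ∈ s.1.filter (adj e) := by simp [ht]
    have := length_filter_ne (h₁.nodup hS) (List.mem_filter.1 hts).1
    refine ⟨List.filter_sublist.trans h₁, ?_⟩
    dsimp only
    rw [List.length_cons]
    omega
  · rw [hs]
    rcases s with ⟨_ | ⟨u, S'⟩, P⟩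
    · exact ⟨h₁, h₂⟩
    · obtain ⟨e, he, t, ht⟩ := h _ h₁ (by simp)
      exact absurd ht (hn e he t)

theorem List.Nodup.eq_singleton {α : Type} {l : List α} (hl : l.Nodup) {a : α} (ha : a ∈ l)
    (h : ∀ b ∈ l, b = a) : l = [a] := by
  rcases l with _ | ⟨b, _ | ⟨c, l⟩⟩
  · simp at ha
  · rw [h b (by simp)]
  · have := (h b (by simp)).trans (h c (by simp)).symm
    simp [this] at hl

/-- A set that contains all or none of the neighbours in `S` of each entry of `E`. -/
def IsClosedUnder (adj : α → α → Bool) (E S : List α) (Y : Finset α) : Prop :=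
  ∀ e ∈ E, ∀ u ∈ S, ∀ v ∈ S, adj e u → adj e v → u ∈ Y → v ∈ Y

/-- If each entry of `E` has at most two neighbours in `S`, then the greedy algorithm gives up at
most one entry of each connected component. -/
theorem length_le_length_greedy_add (hS : S.Nodup)
    (hE : ∀ e ∈ E, ∀ u ∈ S, ∀ v ∈ S, ∀ w ∈ S, adj e u → adj e v → adj e w →
      u = v ∨ u = w ∨ v = w)
    (C : Finset α)
    (hC : ∀ Y : Finset α, IsClosedUnder adj E S Y → (∃ u ∈ S, u ∈ Y) → ∃ u ∈ C, u ∈ Y) :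
    S.length ≤ (greedy adj E S).length + C.card := by
  -- The invariant says that, for every closed `Y` containing all removed entries, at most `(C ∩
  -- Y).card` entries have been given up so far. Quantifying over `Y` allows passing to a smaller
  -- closed set whenever the algorithm gets stuck.
  suffices h : ([] : List α).Sublist S ∧ ∀ Y : Finset α, IsClosedUnder adj E S Y →
      (∀ u ∈ S, u ∉ ([] : List α) → u ∈ Y) →
      S.length ≤ ([] : List α).length + (greedy adj E S).length + (C ∩ Y).card by
    have := h.2 S.toFinset (fun _ _ _ _ v hv _ _ _ => List.mem_toFinset.2 hv)
      (fun u hu _ => List.mem_toFinset.2 hu)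
    have h₂ := Finset.card_le_card (Finset.inter_subset_left (s₁ := C) (s₂ := S.toFinset))
    rw [List.length_nil] at this
    omega
  refine greedy_induction (fun S' P => S'.Sublist S ∧ ∀ Y : Finset α, IsClosedUnder adj E S Y →
      (∀ u ∈ S, u ∉ S' → u ∈ Y) → S.length ≤ S'.length + P.length + (C ∩ Y).card)
    ⟨.refl _, by simp only [List.length_nil]; omega⟩ ?_
  rintro ⟨S', P⟩ ⟨h₁, h₂⟩
  dsimp only at h₁ h₂
  rcases greedyStep_cases (adj := adj) (E := E) (S', P) with ⟨e, he, t, ht, hs⟩ | ⟨hn, hs⟩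
  · rw [hs]
    dsimp only at ht ⊢
    have hts : t ∈ S'.filter (adj e) := by simp [ht]
    have h₃ := length_filter_ne (h₁.nodup hS) (List.mem_filter.1 hts).1
    refine ⟨List.filter_sublist.trans h₁, fun Y hY hSY => ?_⟩
    have := h₂ Y hY fun u hu hu' => hSY u hu fun h => hu' (List.mem_filter.1 h).1
    rw [List.length_cons]
    omega
  · rw [hs]
    refine ⟨(List.tail_sublist _).trans h₁, fun Y hY hSY => ?_⟩
    dsimp only at hn hSY ⊢
    rcases S' with _ | ⟨p, S'⟩
    · exact h₂ Y hY hSY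
    -- The set of removed entries. Being stuck means that no entry of `E` has exactly one remaining
    -- neighbour; as it has at most two neighbours in all, `X` is closed.
    let X : Finset α := S.toFinset.filter (· ∉ p :: S')
    have hX : ∀ u, u ∈ X ↔ u ∈ S ∧ u ∉ p :: S' := by simp [X]
    have hXc : IsClosedUnder adj E S X := by
      intro e he u hu v hv heu hev huX
      refine (hX v).2 ⟨hv, fun hvS => ?_⟩
      refine hn e he v ?_
      refine ((h₁.nodup hS).filter _).eq_singleton (List.mem_filter.2 ⟨hvS, hev⟩) fun w hw => ?_
      obtain ⟨hw, hew⟩ := List.mem_filter.1 hw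
      rcases hE e he u hu v hv w (h₁.subset hw) heu hev hew with rfl | rfl | h
      · exact absurd hvS ((hX u).1 huX).2
      · exact absurd hw ((hX u).1 huX).2
      · exact h.symm
    have hXY : X ⊆ Y := fun u hu => hSY u ((hX u).1 hu).1 fun h =>
      ((hX u).1 hu).2 (List.mem_of_mem_tail h)
    have hpS : p ∈ S := h₁.subset (by simp)
    -- `Y \ X` is closed and contains `p`, so it meets `C`. That element of `C` is not counted by
    -- the invariant for `X` and pays for giving up `p`.
    have hd : IsClosedUnder adj E S (Y \ X) := by
      intro e he u hu v hv heu hev huX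
      rw [Finset.mem_sdiff] at huX ⊢
      exact ⟨hY e he u hu v hv heu hev huX.1, fun hvX => huX.2 (hXc e he v hv u hu hev heu hvX)⟩
    have hpY : p ∈ Y := hSY p hpS (List.nodup_cons.1 (h₁.nodup hS)).1
    obtain ⟨c, hcC, hcY⟩ := hC _ hd ⟨p, hpS, by simp [hpY, hX]⟩
    have h₃ := h₂ X hXc fun u hu hu' => (hX u).2 ⟨hu, hu'⟩
    have h₄ : (C ∩ X).card < (C ∩ Y).card := by
      refine Finset.card_lt_card (Finset.ssubset_iff_of_subset
        (Finset.inter_subset_inter_left hXY) |>.2 ⟨c, ?_, ?_⟩)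
      · exact Finset.mem_inter.2 ⟨hcC, (Finset.mem_sdiff.1 hcY).1⟩
      · exact fun h => (Finset.mem_sdiff.1 hcY).2 (Finset.mem_inter.1 h).2
    simp only [List.length_cons, List.tail_cons] at h₃ ⊢
    omega

/-! ### Positions in a collapse sequence -/

namespace IsCollapseSeq

variable {P : List (α × α)}

/-- The contrapositive of `pairwise` in terms of positions, which is the form used by ranks and by
induction along collapses. -/
theorem idxOf_lt (hP : IsCollapseSeq adj P) {p q : α × α} (hp : p ∈ P) (hq : q ∈ P) (hpq : p ≠ q)
    (h : adj q.1 p.2) :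
    P.idxOf q < P.idxOf p := by
  by_contra! hle
  have hlt : P.idxOf p < P.idxOf q := lt_of_le_of_ne hle fun h => hpq ((List.idxOf_inj hp).1 h)
  have := List.pairwise_iff_getElem.1 hP.pairwise _ _ (List.idxOf_lt_length_iff.2 hp)
    (List.idxOf_lt_length_iff.2 hq) hlt
  simp only [List.getElem_idxOf] at this
  exact this h

/-- Two distinct pairs with a common component would each have to precede the other. -/
theorem eq_of_fst_eq (hP : IsCollapseSeq adj P) {p q : α × α} (hp : p ∈ P) (hq : q ∈ P)
    (h : p.1 = q.1) : p = q := by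
  by_contra hpq
  have h₁ := hP.idxOf_lt hp hq hpq (h ▸ hP.adj_of_mem p hp)
  have h₂ := hP.idxOf_lt hq hp (Ne.symm hpq) (h ▸ hP.adj_of_mem q hq)
  omega

theorem eq_of_snd_eq (hP : IsCollapseSeq adj P) {p q : α × α} (hp : p ∈ P) (hq : q ∈ P)
    (h : p.2 = q.2) : p = q := by
  by_contra hpq
  have h₁ := hP.idxOf_lt hp hq hpq (h ▸ hP.adj_of_mem q hq)
  have h₂ := hP.idxOf_lt hq hp (Ne.symm hpq) (h ▸ hP.adj_of_mem p hp)
  omega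

end IsCollapseSeq

end Greedy

/-! ### Thinning out by periodic masks -/

section Masks

variable {α : Type}

theorem IsCollapseSeq.nodup {adj : α → α → Bool} {P : List (α × α)}
    (hP : IsCollapseSeq adj P) : P.Nodup := by
  refine hP.pairwise.imp_of_mem fun {p q} hp hq h hpq => h ?_
  rw [← hpq]
  exact hP.adj_of_mem p hp

/-- Doubling stops only when there are more masks than entries of `T`. The `T.length` rounds
available suffice, because `n < 2 ^ n`. -/
theorem exists_masks (T : List α) : ∃ g, T.length < 2 ^ g ∧ (T ≠ [] → 0 < g) ∧
    ∀ m : List Bool, m.length = g → m ∈ masks T := by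
  -- Either doubling has stopped, or every round so far has doubled the list.
  have key : ∀ T' : List α, ∃ g,
      (T.length < 2 ^ g ∨ g = T'.length) ∧ ∀ acc, acc = T'.foldl (fun acc _ =>
        bif leLength acc T then acc.map (fun m => true :: m) ++ acc.map (fun m => false :: m)
        else acc) [[]] → acc.length = 2 ^ g ∧ ∀ m : List Bool, m.length = g → m ∈ acc := by
    intro T'
    induction T' using List.reverseRecOn with
    | nil => exact ⟨0, by simp⟩
    | append_singleton T' t ih =>
      obtain ⟨g, hg, ih⟩ := ih
      obtain ⟨h₁, h₂⟩ := ih _ rfl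
      simp only [List.foldl_append, List.foldl_cons, List.foldl_nil]
      generalize T'.foldl _ [[]] = acc at h₁ h₂
      cases h : leLength acc T
      · refine ⟨g, .inl ?_, ?_⟩
        · rw [← h₁]
          by_contra! hle
          simp [leLength_iff.2 hle] at h
        · rintro _ rfl
          exact ⟨h₁, h₂⟩
      · rw [leLength_iff, h₁] at h
        have hg : g = T'.length := hg.resolve_left (by omega)
        refine ⟨g + 1, .inr (by simp [hg]), ?_⟩
        rintro _ rfl
        refine ⟨by simp [h₁, pow_succ, mul_two], fun m hm => ?_⟩
        rcases m with _ | ⟨b, m⟩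
        · simp at hm
        · have := h₂ m (by simpa using hm)
          cases b <;> simp [this]
  obtain ⟨g, hg, h⟩ := key T
  have hlt : T.length < 2 ^ g := hg.elim (fun h => h) fun h => h ▸ Nat.lt_two_pow_self
  refine ⟨g, hlt, fun hT => Nat.pos_of_ne_zero ?_, (h _ rfl).2⟩
  rintro rfl
  have := List.length_pos_iff.2 hT
  omega

/-- The mask is rotated by one place per entry, so its head at position `i` is `m[i % g]`, and this
decides whether the entry there is dropped. -/
theorem foldl_thinStep {m : List Bool} {g : ℕ} (hg : 0 < g) (hm : m.length = g) (T : List α) :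
    T.foldl thinStep (m, []) = (m.rotate T.length, thin m T) ∧
    (thin m T).length +
      ((Finset.range T.length).filter fun i => m[i % g]? = some true).card = T.length ∧
    ∀ t ∈ thin m T, ∃ i : ℕ, T[i]? = some t ∧ m[i % g]? = some false := by
  induction T using List.reverseRecOn with
  | nil => simp [thin]
  | append_singleton T t ih =>
    obtain ⟨h₁, h₂, h₃⟩ := ih
    have hhead : (m.rotate T.length).head? = m[T.length % g]? := by
      rw [← List.rotate_mod, hm, List.head?_rotate (by rw [hm]; exact Nat.mod_lt _ hg)]
    have hthin : thin m (T ++ [t]) = ((T ++ [t]).foldl thinStep (m, [])).2 := rfl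
    rw [List.foldl_append, h₁, List.foldl_cons, List.foldl_nil] at hthin ⊢
    rcases hr : m.rotate T.length with _ | ⟨b, m'⟩
    · rw [← List.length_rotate (n := T.length), hr, List.length_nil] at hm
      omega
    rw [hr, List.head?_cons] at hhead
    rw [hr] at hthin
    have hrot : m.rotate (T.length + 1) = m' ++ [b] := by
      rw [← List.rotate_rotate, hr]
      simp
    have hlift : ∀ t' ∈ thin m T, ∃ i : ℕ, (T ++ [t])[i]? = some t' ∧
        m[i % g]? = some false := by
      intro t' ht'
      obtain ⟨i, hi, hi'⟩ := h₃ t' ht'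
      exact ⟨i, by rw [List.getElem?_append_left (List.getElem?_eq_some_iff.1 hi).1, hi], hi'⟩
    simp only [thinStep] at hthin ⊢
    rw [List.length_append, List.length_singleton, hrot, hthin, Finset.range_add_one,
      Finset.filter_insert, ← hhead]
    cases b
    · refine ⟨rfl, by simp; omega, fun t' ht' => ?_⟩
      rcases List.mem_cons.1 ht' with rfl | ht'
      · exact ⟨T.length, by simp, hhead.symm⟩
      · exact hlift t' ht'
    · refine ⟨rfl, ?_, hlift⟩
      simp
      omega

/-- Kept entries are pushed to the front, whence the reversal. The lemma provides distinctness and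
size bounds. -/
theorem thin_sublist_reverse (m : List Bool) (T : List α) : (thin m T).Sublist T.reverse := by
  induction T using List.reverseRecOn with
  | nil => simp [thin]
  | append_singleton T t ih =>
    have hthin : thin m (T ++ [t]) = (thinStep (T.foldl thinStep (m, [])) t).2 := by
      simp [thin]
    rw [hthin, List.reverse_append, List.reverse_singleton, List.singleton_append]
    have : (T.foldl thinStep (m, [])).2.Sublist T.reverse := ih
    generalize T.foldl thinStep (m, []) = s at this
    rcases s with ⟨_ | ⟨_ | _, m'⟩, K⟩
    · exact this.cons _
    · exact this.cons_cons _
    · exact this.cons _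

/-- Some mask removes all entries of `T` that belong to `C`, and not many others. -/
theorem exists_mask_thin (T : List α) (hT : T.Nodup) (C : Finset α) :
    ∃ g, T.length < 2 ^ g ∧ (T ≠ [] → 0 < g) ∧ ∃ m ∈ masks T, (∀ t ∈ thin m T, t ∉ C) ∧
      T.length ≤ (thin m T).length + C.card * (T.length / g + 1) := by
  obtain ⟨g, hg, hg₀, h⟩ := exists_masks T
  refine ⟨g, hg, hg₀, ?_⟩
  rcases eq_or_ne T [] with rfl | hne
  · exact ⟨List.replicate g false, h _ (by simp), by simp [thin], by simp⟩
  have hg₀ := hg₀ hne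
  classical
  let I : Finset ℕ := (Finset.range T.length).filter fun i => ∃ t ∈ C, T[i]? = some t
  have hI : I.card ≤ C.card := by
    refine Finset.card_le_card_of_injOn (fun i => (T[i]?).getD (T.head hne)) ?_ ?_
    · intro i hi
      obtain ⟨_, t, ht, hit⟩ := Finset.mem_filter.1 hi
      simpa [hit] using ht
    · intro i hi j hj hij
      obtain ⟨hi', t, ht, hit⟩ := Finset.mem_filter.1 hi
      obtain ⟨hj', u, hu, hju⟩ := Finset.mem_filter.1 hj
      simp only [hit, hju, Option.getD_some] at hij
      exact (List.getElem?_inj (Finset.mem_range.1 hi') hT).1 (by rw [hit, hju, hij])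
  -- Mark the residues modulo `g` of the positions of elements of `C`.
  let m : List Bool := (List.range g).map fun j => decide (∃ i ∈ I, i % g = j)
  have hm : m.length = g := by simp [m]
  have hmi : ∀ i b, m[i % g]? = some b ↔ b = decide (∃ i' ∈ I, i' % g = i % g) := by
    intro i b
    simp [m, List.getElem?_range (Nat.mod_lt i hg₀), eq_comm]
  obtain ⟨-, h₂, h₃⟩ := foldl_thinStep hg₀ hm T
  refine ⟨m, h m hm, ?_, ?_⟩
  · intro t ht htC
    obtain ⟨i, hi, hi'⟩ := h₃ t ht
    rw [hmi, eq_comm, decide_eq_false_iff_not] at hi'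
    exact hi' ⟨i, Finset.mem_filter.2 ⟨Finset.mem_range.2 (List.getElem?_eq_some_iff.1 hi).1,
      t, htC, hi⟩, rfl⟩
  · have : ((Finset.range T.length).filter fun i => m[i % g]? = some true).card ≤
        I.card * (T.length / g + 1) := by
      have hsub : ((Finset.range T.length).filter fun i => m[i % g]? = some true) ⊆
          I.biUnion fun i' => (Finset.range T.length).filter fun i => i ≡ i' [MOD g] := by
        intro i hi
        obtain ⟨hi, hi'⟩ := Finset.mem_filter.1 hi
        rw [hmi, eq_comm, decide_eq_true_iff] at hi'
        obtain ⟨i', hi'I, hmod⟩ := hi'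
        exact Finset.mem_biUnion.2 ⟨i', hi'I, Finset.mem_filter.2 ⟨hi, hmod.symm⟩⟩
      refine (Finset.card_le_card hsub).trans (Finset.card_biUnion_le_card_mul _ _ _ ?_)
      intro i' _
      -- A residue class modulo `g` has at most `T.length / g + 1` members below `T.length`.
      rw [← Nat.count_eq_card_filter_range, Nat.count_modEq_card _ hg₀]
      split_ifs <;> omega
    have := Nat.mul_le_mul_right (T.length / g + 1) hI
    omega

end Masks

/-! ### The best greedy matching over all masks -/

section Greedy

variable {α : Type} [DecidableEq α] {adj : α → α → Bool} {E T : List α}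

/-- The first half transfers the correctness of a single greedy run; the second allows comparison
with the one mask suited to the optimum. -/
theorem bestGreedy_spec (E T : List α) :
    (bestGreedy adj E T = [] ∨ ∃ m ∈ masks T, bestGreedy adj E T = greedy adj E (thin m T)) ∧
    ∀ m ∈ masks T, (greedy adj E (thin m T)).length ≤ (bestGreedy adj E T).length := by
  have key : ∀ M : List (List Bool), ∀ B, B = M.foldl (fun best m =>
      bif leLength (greedy adj E (thin m T)) best then best else greedy adj E (thin m T)) [] →
      (B = [] ∨ ∃ m ∈ M, B = greedy adj E (thin m T)) ∧
      ∀ m ∈ M, (greedy adj E (thin m T)).length ≤ B.length := by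
    intro M
    induction M using List.reverseRecOn with
    | nil => simp
    | append_singleton M m ih =>
      obtain ⟨h₁, h₂⟩ := ih _ rfl
      simp only [List.foldl_append, List.foldl_cons, List.foldl_nil]
      rintro _ rfl
      generalize M.foldl _ [] = B at h₁ h₂
      simp only [List.mem_append, List.mem_singleton]
      cases h : leLength (greedy adj E (thin m T)) B
      · have h : B.length < (greedy adj E (thin m T)).length := by
          by_contra! hle
          simp [leLength_iff.2 hle] at h
        refine ⟨.inr ⟨m, .inr rfl, rfl⟩, ?_⟩
        rintro m' (hm' | rfl)
        · exact (h₂ m' hm').trans h.le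
        · rfl
      · refine ⟨h₁.imp_right fun ⟨m, hm, h⟩ => ⟨m, .inl hm, h⟩, ?_⟩
        rintro m' (hm' | rfl)
        · exact h₂ m' hm'
        · exact leLength_iff.1 h
  exact key _ _ rfl

theorem isCollapseSeq_bestGreedy : IsCollapseSeq adj (bestGreedy adj E T) ∧
    ∀ p ∈ bestGreedy adj E T, p.1 ∈ E ∧ p.2 ∈ T := by
  rcases (bestGreedy_spec (adj := adj) E T).1 with h | ⟨m, -, h⟩
  · rw [h]
    exact ⟨⟨by simp, by simp⟩, by simp⟩
  · rw [h]
    refine ⟨isCollapseSeq_greedy.1, fun p hp => ?_⟩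
    have := isCollapseSeq_greedy.2 p hp
    exact ⟨this.1, by simpa using (thin_sublist_reverse m T).subset this.2⟩

theorem mem_unmatched {P : List (α × α)} {e : α} :
    e ∈ unmatched E P ↔ e ∈ E ∧ ∀ p ∈ P, p.1 ≠ e := by
  simp [unmatched, List.filter_eq_nil_iff]

end Greedy

/-! ## The algorithm runs in polynomial time -/

/-- Each round adds at most one pair, taken from `E` and `S`, so the state stays small enough for
`PolyTime.foldl`. -/
theorem greedyStep_size_invariant {β : Type} [DecidableEq β] {adj : β → β → Bool}
    {E S S' : List β} {P : List (β × β)} {n : ℕ}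
    (h : S'.Sublist S ∧ P.length ≤ n ∧ ∀ p ∈ P, p.1 ∈ E ∧ p.2 ∈ S) :
    (greedyStep adj E (S', P)).1.Sublist S ∧
      (greedyStep adj E (S', P)).2.length ≤ n + 1 ∧
      ∀ p ∈ (greedyStep adj E (S', P)).2, p.1 ∈ E ∧ p.2 ∈ S := by
  obtain ⟨h₁, h₂, h₃⟩ := h
  rcases greedyStep_cases (adj := adj) (E := E) (S', P) with ⟨e, he, t, ht, hs⟩ | ⟨-, hs⟩
  · rw [hs]
    have hts : t ∈ S'.filter (adj e) := by simp [ht]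
    refine ⟨List.filter_sublist.trans h₁, by simpa using h₂, ?_⟩
    intro p hp
    rcases List.mem_cons.1 hp with rfl | hp
    · exact ⟨he, h₁.subset (List.mem_filter.1 hts).1⟩
    · exact h₃ p hp
  · rw [hs]
    exact ⟨(List.tail_sublist _).trans h₁, h₂.trans (Nat.le_succ n), h₃⟩

namespace PolyTime

variable {α β γ δ : Type} [Enc α] [Enc β] [Enc γ] [Enc δ]

theorem isSingleton {l : α → List β} (hl : PolyTime l) : PolyTime fun a => (l a).isSingleton :=
  (hl.isEmpty.not).and hl.tail.isEmpty

theorem leLength {l₁ : α → List β} {l₂ : α → List γ} (h₁ : PolyTime l₁) (h₂ : PolyTime l₂) :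
    PolyTime fun a => leLength (l₁ a) (l₂ a) := by
  obtain ⟨q, hq⟩ := h₁.size_le
  refine isEmpty (foldl (f := fun _ l _ => l.tail) (tail (fst (snd id))) h₁ h₂ q ?_)
  intro a l' _
  rw [foldl_tail]
  exact (encSize_le_of_sublist (List.drop_sublist _ _)).trans (hq a)

theorem neighbours {adj : β → β → Bool} (hadj : PolyTime fun x : β × β => adj x.1 x.2)
    {e : α → β} {S : α → List β}
    (he : PolyTime e) (hS : PolyTime S) : PolyTime fun a => (S a).filter (adj (e a)) :=
  filter (p := fun a => adj (e a)) (hadj.comp (pair (he.comp (fst id)) (snd id))) hS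

section Greedy

variable [DecidableEq β] {adj : β → β → Bool}

theorem greedyStep (hadj : PolyTime fun x : β × β => adj x.1 x.2) :
    PolyTime fun x : List β × List β × List (β × β) => greedyStep adj x.1 x.2 := by
  have hgive : PolyTime fun x : List β × List β × List (β × β) => (x.2.1.tail, x.2.2) :=
    pair (tail (fst (snd id))) (snd (snd id))
  have hE : PolyTime fun x : List β × List β × List (β × β) =>
      x.1.filter fun e => (x.2.1.filter (adj e)).isSingleton :=
    filter (p := fun (x : List β × List β × List (β × β)) e => (x.2.1.filter (adj e)).isSingleton)
      (isSingleton (neighbours hadj (snd id) (fst (snd (fst id))))) (fst id)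
  refine listCase hE hgive (g := fun (x : List β × List β × List (β × β)) e _ =>
    match x.2.1.filter (adj e) with
    | [] => (x.2.1.tail, x.2.2)
    | t :: _ => (x.2.1.filter (fun u => !decide (u = t)), (e, t) :: x.2.2)) ?_
  refine listCase (neighbours hadj (fst (snd id)) (fst (snd (fst id)))) (hgive.comp (fst id))
    (g := fun (x : (List β × List β × List (β × β)) × β × List β) t _ =>
      (x.1.2.1.filter (fun u => !decide (u = t)), (x.2.1, t) :: x.1.2.2)) ?_
  refine pair (filter
    (p := fun (x : ((List β × List β × List (β × β)) × β × List β) × β × List β) u =>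
    !decide (u = x.2.1))
    (not (decide_eq (snd id) (fst (snd (fst id))))) (fst (snd (fst (fst id))))) ?_
  exact cons (pair (fst (snd (fst id))) (fst (snd id))) (snd (snd (fst (fst id))))

theorem greedy (hadj : PolyTime fun x : β × β => adj x.1 x.2) {E S : α → List β}
    (hE : PolyTime E) (hS : PolyTime S) : PolyTime fun a => greedy adj (E a) (S a) := by
  obtain ⟨q, hq⟩ := hE.size_le
  obtain ⟨r, hr⟩ := hS.size_le
  refine snd (foldl (f := fun a s _ => _root_.greedyStep adj (E a) s) (b := fun a => (S a, []))
    ((greedyStep hadj).comp (pair (hE.comp (fst id)) (fst (snd id)))) (pair hS nil) hS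
    (r + (r * (q + r + 1 + 1) + 1) + 1) ?_)
  intro a l' hl'
  have key : ∀ l' : List β, ∃ s : List β × List (β × β),
      l'.foldl (fun s _ => _root_.greedyStep adj (E a) s) (S a, []) = s ∧
      s.1.Sublist (S a) ∧ s.2.length ≤ l'.length ∧ ∀ p ∈ s.2, p.1 ∈ E a ∧ p.2 ∈ S a := by
    intro l'
    induction l' using List.reverseRecOn with
    | nil => exact ⟨_, rfl, .refl _, by simp, by simp⟩
    | append_singleton l' b ih =>
      obtain ⟨s, hs, ih⟩ := ih
      refine ⟨_, rfl, ?_⟩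
      rw [List.foldl_append, hs, List.length_append]
      exact _root_.greedyStep_size_invariant ih
  obtain ⟨s, hs, h₁, h₂, h₃⟩ := key l'
  rw [hs]
  have h₄ : ∀ p ∈ s.2, encSize p ≤ q.eval (encSize a) + r.eval (encSize a) + 1 := by
    intro p hp
    have h₅ := encSize_lt_of_mem (h₃ p hp).1
    have h₆ := encSize_lt_of_mem (h₃ p hp).2
    have h₇ := hq a
    have h₈ := hr a
    change encSize p.1 + encSize p.2 + 1 ≤ _
    omega
  have h₅ : s.2.length ≤ r.eval (encSize a) :=
    (h₂.trans hl'.length_le).trans ((length_lt_encSize _).le.trans (hr a))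
  have h₆ := (encSize_list_le h₄).trans (Nat.add_le_add_right (Nat.mul_le_mul_right _ h₅) 1)
  have h₇ := (encSize_le_of_sublist h₁).trans (hr a)
  change encSize s.1 + encSize s.2 + 1 ≤ _
  simp only [Polynomial.eval_add, Polynomial.eval_mul, Polynomial.eval_one]
  omega

end Greedy

theorem thinStep : PolyTime fun x : (List Bool × List β) × β => thinStep x.1 x.2 := by
  have h := listCase (l := fun x : (List Bool × List β) × β => x.1.1)
    (g := fun x b m => (m ++ [b], bif b then x.1.2 else x.2 :: x.1.2))
    (fst (fst id)) (fst id) ?_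
  · convert h using 2 with x
    rcases x with ⟨⟨_ | ⟨b, m⟩, l⟩, t⟩ <;> rfl
  · refine pair (append (snd (snd id)) (cons (fst (snd id)) nil)) ?_
    exact cond (fst (snd id)) (snd (fst (fst id))) (cons (snd (fst id)) (snd (fst (fst id))))

/-- The mask is only rotated, which preserves the size of its code, and the kept entries are among
those read. -/
theorem thin {m : α → List Bool} {T : α → List β} (hm : PolyTime m) (hT : PolyTime T) :
    PolyTime fun a => thin (m a) (T a) := by
  obtain ⟨q, hq⟩ := hm.size_le
  obtain ⟨r, hr⟩ := hT.size_le
  refine snd (foldl (f := fun _ s t => _root_.thinStep s t) (b := fun a => (m a, []))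
    (thinStep.comp (snd id)) (pair hm nil) hT (q + r + 1) ?_)
  · intro a l' hl'
    have key : ∀ l' : List β, encSize (l'.foldl _root_.thinStep (m a, [])).1 = encSize (m a) := by
      intro l'
      induction l' using List.reverseRecOn with
      | nil => rfl
      | append_singleton l' t ih =>
        rw [List.foldl_append, List.foldl_cons, List.foldl_nil, ← ih]
        generalize l'.foldl _root_.thinStep (m a, []) = s
        rcases s with ⟨_ | ⟨b, m'⟩, K⟩
        · rfl
        · have := encSize_append m' [b]
          simp only [_root_.thinStep, encSize_cons, encSize_nil] at this ⊢
          omega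
    have h₁ : encSize (l'.foldl _root_.thinStep (m a, [])).2 ≤ encSize l' := by
      rw [← encSize_reverse l']
      exact encSize_le_of_sublist (thin_sublist_reverse _ _)
    have h₂ := (encSize_le_of_sublist hl'.sublist).trans (hr a)
    have h₃ := key l'
    have h₄ := hq a
    change encSize (l'.foldl _root_.thinStep (m a, [])).1 +
      encSize (l'.foldl _root_.thinStep (m a, [])).2 + 1 ≤ _
    simp only [Polynomial.eval_add, Polynomial.eval_one]
    omega

theorem masks {T : α → List β} (hT : PolyTime T) : PolyTime fun a => masks (T a) := by
  obtain ⟨r, hr⟩ := hT.size_le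
  refine foldl (f := fun a acc _ => bif _root_.leLength acc (T a) then
      acc.map (fun m => Bool.true :: m) ++ acc.map (fun m => Bool.false :: m) else acc)
    (b := fun _ => [[]]) (cond (leLength (fst (snd id)) (hT.comp (fst id)))
      (append (map (f := fun _ m => Bool.true :: m) (cons true (snd id)) (fst (snd id)))
        (map (f := fun _ m => Bool.false :: m) (cons false (snd id)) (fst (snd id))))
      (fst (snd id))) (cons nil nil) hT ((2 * r + 1) * (r * 4 + 1 + 1) + 1) ?_
  intro a l' hl'
  -- The number of masks doubles only while it is at most `(T a).length`, and each round lengthens a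
  -- mask by at most one bit.
  have key : ∀ l' : List β, ∃ acc, l'.foldl (fun acc _ => bif _root_.leLength acc (T a) then
      acc.map (fun m => Bool.true :: m) ++ acc.map (fun m => Bool.false :: m) else acc) [[]] = acc ∧
      acc.length ≤ 2 * (T a).length + 1 ∧ ∀ m ∈ acc, m.length ≤ l'.length := by
    intro l'
    induction l' using List.reverseRecOn with
    | nil => exact ⟨[[]], rfl, by simp, by simp⟩
    | append_singleton l' t ih =>
      obtain ⟨acc, hacc, h₁, h₂⟩ := ih
      refine ⟨_, rfl, ?_⟩
      rw [List.foldl_append, hacc, List.foldl_cons, List.foldl_nil, List.length_append]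
      cases h : _root_.leLength acc (T a)
      · exact ⟨h₁, fun m hm => (h₂ m hm).trans (Nat.le_add_right _ _)⟩
      · rw [leLength_iff] at h
        refine ⟨by simp; omega, fun m hm => ?_⟩
        simp only [cond_true, List.mem_append, List.mem_map] at hm
        rcases hm with ⟨m, hm, rfl⟩ | ⟨m, hm, rfl⟩ <;> simpa using h₂ m hm
  obtain ⟨acc, hacc, h₁, h₂⟩ := key l'
  rw [hacc]
  have h₃ := (length_lt_encSize (T a)).le.trans (hr a)
  -- The code of a truth value has at most three nodes, and one more joins it to the list.
  have h₄ : ∀ m ∈ acc, encSize m ≤ r.eval (encSize a) * 4 + 1 := by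
    intro m hm
    refine (encSize_list_le (B := 3) fun b _ => by cases b <;> decide).trans ?_
    have := h₂ m hm
    have := hl'.length_le
    omega
  refine (encSize_list_le h₄).trans ?_
  simp only [Polynomial.eval_add, Polynomial.eval_mul, Polynomial.eval_one, Polynomial.eval_ofNat]
  gcongr
  omega

/-- Every intermediate value is empty or the result of a single greedy run, so the size bound for
one run serves for the fold. -/
theorem bestGreedy [DecidableEq β] {adj : β → β → Bool}
    (hadj : PolyTime fun x : β × β => adj x.1 x.2) {E T : α → List β}
    (hE : PolyTime E) (hT : PolyTime T) : PolyTime fun a => bestGreedy adj (E a) (T a) := by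
  have hg : PolyTime fun x : α × List Bool =>
      _root_.greedy adj (E x.1) (_root_.thin x.2 (T x.1)) :=
    greedy hadj (hE.comp (fst id)) (thin (snd id) (hT.comp (fst id)))
  obtain ⟨q, hq⟩ := hg.size_le
  obtain ⟨r, hr⟩ := hT.masks.size_le
  have hg' : PolyTime fun x : α × List (β × β) × List Bool =>
      _root_.greedy adj (E x.1) (_root_.thin x.2.2 (T x.1)) :=
    hg.comp (pair (fst id) (snd (snd id)))
  refine foldl (f := fun a best m =>
      bif _root_.leLength (_root_.greedy adj (E a) (_root_.thin m (T a))) best then best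
      else _root_.greedy adj (E a) (_root_.thin m (T a)))
    (cond (leLength hg' (fst (snd id))) (fst (snd id)) hg') nil hT.masks
    (q.comp (.X + r + 1) + 1) ?_
  intro a l' hl'
  have key : ∀ l' : List (List Bool), l' <+: _root_.masks (T a) → encSize (l'.foldl (fun best m =>
      bif _root_.leLength (_root_.greedy adj (E a) (_root_.thin m (T a))) best then best
      else _root_.greedy adj (E a) (_root_.thin m (T a))) []) ≤
      q.eval (encSize a + r.eval (encSize a) + 1) + 1 := by
    intro l'
    induction l' using List.reverseRecOn with
    | nil => simp [encSize_nil]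
    | append_singleton l' m ih =>
      intro h
      have ih := ih ((List.prefix_append _ _).trans h)
      rw [List.foldl_append, List.foldl_cons, List.foldl_nil]
      generalize l'.foldl _ [] = best at ih
      cases _root_.leLength (_root_.greedy adj (E a) (_root_.thin m (T a))) best
      · refine (hq (a, m)).trans ((q.eval_mono_nat ?_).trans (Nat.le_succ _))
        have := (encSize_lt_of_mem (h.subset (by simp : m ∈ l' ++ [m]))).le.trans (hr a)
        rw [encSize_pair]
        omega
      · exact ih
  simpa using key l' hl'

theorem unmatched [DecidableEq β] {E : α → List β} {P : α → List (β × β)}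
    (hE : PolyTime E) (hP : PolyTime P) : PolyTime fun a => unmatched (E a) (P a) :=
  filter (p := fun a e => ((P a).filter fun p : β × β => decide (p.1 = e)).isEmpty)
    (isEmpty (filter (p := fun (x : α × β) (p : β × β) => decide (p.1 = x.2))
      (decide_eq (f := fun x : (α × β) × β × β => x.2.1) (fst (snd id)) (snd (fst id)))
      (hP.comp (fst id)))) hE

/-! ### Finite sets of natural numbers, and the whole algorithm -/

theorem sort {s : α → Finset ℕ} (hs : PolyTime s) : PolyTime fun a => (s a).sort (· ≤ ·) :=
  comp (g := fun s : Finset ℕ => s.sort (· ≤ ·)) (of_enc_eq fun _ => rfl) hs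

theorem decide_subset {s t : α → Finset ℕ} (hs : PolyTime s) (ht : PolyTime t) :
    PolyTime fun a => decide (s a ⊆ t a) := by
  convert isEmpty (filter (p := fun a i =>
      (((t a).sort (· ≤ ·)).filter fun j => decide (i = j)).isEmpty)
    (isEmpty (filter (p := fun x j => decide (x.2 = j)) (decide_eq (snd (fst id)) (snd id))
      (sort (ht.comp (fst id))))) (sort hs)) using 2 with a
  rw [Bool.eq_iff_iff]
  simp only [decide_eq_true_iff, List.isEmpty_iff, List.filter_eq_nil_iff, Finset.mem_sort]
  constructor
  · intro h i hi h'
    exact h' i (h hi) rfl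
  · intro h i hi
    by_contra hi'
    exact h i hi fun j hj hij => hi' (hij ▸ hj)

theorem comparable : PolyTime fun x : Finset ℕ × Finset ℕ => comparable x.1 x.2 :=
  or (decide_subset (fst id) (snd id)) (decide_subset (snd id) (fst id))

/-- Small cardinalities are read off from the shape of the sorted list, which avoids binary
arithmetic. -/
theorem decide_card_eq_one {s : α → Finset ℕ} (hs : PolyTime s) :
    PolyTime fun a => decide ((s a).card = 1) := by
  convert isSingleton hs.sort using 2 with a
  rw [← Finset.length_sort (· ≤ ·)]
  rcases (s a).sort (· ≤ ·) with _ | ⟨_, _ | ⟨_, _⟩⟩ <;> simp [List.isSingleton]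

theorem decide_card_eq_two {s : α → Finset ℕ} (hs : PolyTime s) :
    PolyTime fun a => decide ((s a).card = 2) := by
  convert isSingleton hs.sort.tail using 2 with a
  rw [← Finset.length_sort (· ≤ ·)]
  rcases (s a).sort (· ≤ ·) with _ | ⟨_, _ | ⟨_, _ | ⟨_, _⟩⟩⟩ <;> simp [List.isSingleton]

theorem decide_card_eq_three {s : α → Finset ℕ} (hs : PolyTime s) :
    PolyTime fun a => decide ((s a).card = 3) := by
  convert isSingleton hs.sort.tail.tail using 2 with a
  rw [← Finset.length_sort (· ≤ ·)]
  rcases (s a).sort (· ≤ ·) with _ | ⟨_, _ | ⟨_, _ | ⟨_, _ | ⟨_, _⟩⟩⟩⟩ <;>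
    simp [List.isSingleton]

theorem upperPairs : PolyTime upperPairs :=
  bestGreedy comparable (filter (p := fun _ (s : Finset ℕ) => decide (s.card = 2))
    (decide_card_eq_two (snd id)) id) (filter (p := fun _ (s : Finset ℕ) => decide (s.card = 3))
    (decide_card_eq_three (snd id)) id)

theorem lowerPairs : PolyTime lowerPairs :=
  greedy comparable (unmatched (filter (p := fun _ (s : Finset ℕ) => decide (s.card = 2))
    (decide_card_eq_two (snd id)) id) upperPairs)
    (filter (p := fun _ (s : Finset ℕ) => decide (s.card = 1))
    (decide_card_eq_one (snd id)) id)

theorem approxMatching : PolyTime approxMatching :=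
  append upperPairs (map (f := fun _ (p : Finset ℕ × Finset ℕ) => (p.2, p.1))
    (pair (snd (snd id)) (fst (snd id)))
    lowerPairs)

end PolyTime

/-! ## Analysis of the algorithm -/

/-- The transitive closure of an acyclic relation is a strict order, so nonempty finite sets have
minimal elements. -/
theorem exists_forall_not_transGen {α : Type} {R : α → α → Prop}
    (h : ∀ a, ¬ Relation.TransGen R a a) {S : Finset α} (hS : S.Nonempty) :
    ∃ a ∈ S, ∀ b ∈ S, ¬ Relation.TransGen R b a := by
  let r : S → S → Prop := fun a b => Relation.TransGen R a b
  have : IsTrans S r := ⟨fun _ _ _ => Relation.TransGen.trans⟩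
  have : Std.Irrefl r := ⟨fun a => h a⟩
  obtain ⟨a, -, ha⟩ := (Finite.wellFounded_of_trans_of_irrefl r).has_min Set.univ
    ⟨⟨_, hS.choose_spec⟩, trivial⟩
  exact ⟨a, a.2, fun b hb => ha ⟨b, hb⟩ trivial⟩

theorem List.idxOf_map_of_forall {α β : Type} [BEq α] [LawfulBEq α] [BEq β] [LawfulBEq β]
    {f : α → β}
    {l : List α} {a : α} (h : ∀ b ∈ l, f b = f a → b = a) :
    (l.map f).idxOf (f a) = l.idxOf a := by
  induction l with
  | nil => rfl
  | cons b l ih =>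
    rw [List.map_cons]
    by_cases hb : b = a
    · rw [List.idxOf_cons_eq _ hb, List.idxOf_cons_eq _ (by rw [hb])]
    · rw [List.idxOf_cons_ne _ hb, List.idxOf_cons_ne _ fun hf => hb (h b (by simp) hf),
        ih fun c hc => h c (by simp [hc])]

theorem subset_of_comparable {s t : Finset ℕ} (h : comparable s t) (hst : s.card < t.card) :
    s ⊆ t := by
  simp only [comparable, Bool.or_eq_true, decide_eq_true_iff] at h
  exact h.resolve_right fun h => absurd (Finset.card_le_card h) (by omega)

theorem superset_of_comparable {s t : Finset ℕ} (h : comparable s t) (hst : t.card < s.card) :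
    t ⊆ s := by
  simp only [comparable, Bool.or_eq_true, decide_eq_true_iff] at h
  exact h.resolve_left fun h => absurd (Finset.card_le_card h) (by omega)

theorem comparable_of_subset {s t : Finset ℕ} (h : s ⊆ t) : comparable s t := by
  simp [comparable, h]

theorem comparable_of_superset {s t : Finset ℕ} (h : t ⊆ s) : comparable s t := by
  simp [comparable, h]

namespace TwoComplex

variable (K : TwoComplex)

/-- The simplices with `k` vertices, in the order of the list. -/
def withCard (k : ℕ) : List (Finset ℕ) := K.list.filter fun s => decide (s.card = k)

variable {K}

theorem mem_withCard {k : ℕ} {s : Finset ℕ} : s ∈ K.withCard k ↔ s ∈ K.faces ∧ s.card = k := by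
  simp [withCard, K.mem_list]

theorem nodup_withCard (k : ℕ) : (K.withCard k).Nodup := K.nodup_list.filter _

theorem nonempty_of_mem {s : Finset ℕ} (h : s ∈ K.faces) : s.Nonempty :=
  (K.isRelLowerSet_faces h).1

theorem mem_of_subset {s t : Finset ℕ} (h : t ∈ K.faces) (hst : s ⊆ t) (hs : s.Nonempty) :
    s ∈ K.faces :=
  (K.isRelLowerSet_faces h).2 hst hs

theorem numTwoSimplices_eq : K.numTwoSimplices = (K.withCard 3).length := by
  rw [← List.toFinset_card_of_nodup (nodup_withCard 3), ← Set.ncard_coe_finset]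
  unfold numTwoSimplices
  congr 1
  ext s
  simp [PreAbstractSimplicialComplex.simplicesOfDim, mem_withCard]

/-! ### The output is a Morse matching -/

section Feasible

variable {P Q : List (Finset ℕ × Finset ℕ)}

/-- The vertex-edge pairs in `Q`, together with the edge-triangle pairs in `P`. -/
def combine (P Q : List (Finset ℕ × Finset ℕ)) : List (Finset ℕ × Finset ℕ) :=
  P ++ Q.map fun p => (p.2, p.1)

theorem mem_combine {p : Finset ℕ × Finset ℕ} : p ∈ combine P Q ↔ p ∈ P ∨ (p.2, p.1) ∈ Q := by
  simp only [combine, List.mem_append, List.mem_map, Prod.exists]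
  refine or_congr_right ⟨?_, fun h => ⟨_, _, h, rfl⟩⟩
  rintro ⟨a, b, h, rfl⟩
  exact h

/-- A function that decreases along the arcs of the modified Hasse diagram. -/
def rank (P Q : List (Finset ℕ × Finset ℕ)) (s : Finset ℕ) : ℕ :=
  -- In each pair the lower simplex ranks one above its partner, as the reversed arc demands.
  -- Critical edges lie between the simplices matched by `P` and those matched by `Q`. Since `idxOf`
  -- returns the length for absent elements, critical triangles come out on top and critical
  -- vertices get rank zero.
  if s.card = 3 then 2 * Q.length + 2 + 2 * (P.map Prod.snd).idxOf s
  else if s.card = 2 then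
    if s ∈ P.map Prod.fst then 2 * Q.length + 3 + 2 * (P.map Prod.fst).idxOf s
    else if s ∈ Q.map Prod.fst then 2 * (Q.length - (Q.map Prod.fst).idxOf s) - 1
    else 2 * Q.length + 1
  else 2 * (Q.length - (Q.map Prod.snd).idxOf s)

/-- An arc that is not reversed joins simplices whose pairs are ordered by `idxOf_lt`, or involves a
critical simplex; either way `rank` drops. -/
theorem isMorseMatching_combine (hP : IsCollapseSeq comparable P)
    (hQ : IsCollapseSeq comparable Q)
    (hP' : ∀ p ∈ P, p.1 ∈ K.withCard 2 ∧ p.2 ∈ K.withCard 3)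
    (hQ' : ∀ q ∈ Q, q.1 ∈ unmatched (K.withCard 2) P ∧ q.2 ∈ K.withCard 1) :
    K.IsMorseMatching {p | p ∈ combine P Q} := by
  simp only [mem_unmatched, mem_withCard] at hP' hQ'
  have hPfst : ∀ p ∈ P, (P.map Prod.fst).idxOf p.1 = P.idxOf p := fun p hp =>
    List.idxOf_map_of_forall fun q hq h => hP.eq_of_fst_eq hq hp h
  have hPsnd : ∀ p ∈ P, (P.map Prod.snd).idxOf p.2 = P.idxOf p := fun p hp =>
    List.idxOf_map_of_forall fun q hq h => hP.eq_of_snd_eq hq hp h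
  have hQfst : ∀ p ∈ Q, (Q.map Prod.fst).idxOf p.1 = Q.idxOf p := fun p hp =>
    List.idxOf_map_of_forall fun q hq h => hQ.eq_of_fst_eq hq hp h
  have hQsnd : ∀ p ∈ Q, (Q.map Prod.snd).idxOf p.2 = Q.idxOf p := fun p hp =>
    List.idxOf_map_of_forall fun q hq h => hQ.eq_of_snd_eq hq hp h
  have hPlt : ∀ p ∈ P, P.idxOf p < P.length := fun p hp => List.idxOf_lt_length_iff.2 hp
  have hQlt : ∀ p ∈ Q, Q.idxOf p < Q.length := fun p hp => List.idxOf_lt_length_iff.2 hp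
  have hfacet : ∀ p ∈ combine P Q, K.IsFacet p.1 p.2 := by
    intro p hp
    rcases mem_combine.1 hp with hp | hp
    · obtain ⟨⟨h₁, h₂⟩, h₃, h₄⟩ := hP' p hp
      exact ⟨h₁, h₃, subset_of_comparable (hP.adj_of_mem p hp) (by omega), by omega⟩
    · obtain ⟨⟨⟨h₁, h₂⟩, -⟩, h₃, h₄⟩ := hQ' _ hp
      dsimp only at *
      exact ⟨h₃, h₁, superset_of_comparable (hQ.adj_of_mem _ hp) (by omega), by omega⟩
  refine ⟨hfacet, ?_, ?_⟩
  · intro p hp q hq hpq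
    rcases mem_combine.1 hp with hp | hp <;> rcases mem_combine.1 hq with hq | hq
    · have h₁ := hP' p hp
      have h₂ := hP' q hq
      refine ⟨fun h => hpq (hP.eq_of_fst_eq hp hq h), fun h => ?_, fun h => ?_,
        fun h => hpq (hP.eq_of_snd_eq hp hq h)⟩ <;> (have := congrArg Finset.card h; omega)
    · have h₁ := hP' p hp
      have h₂ := hQ' _ hq
      dsimp only at h₂
      refine ⟨fun h => ?_, fun h => h₂.1.2 p hp h, fun h => ?_, fun h => ?_⟩ <;>
        (have := congrArg Finset.card h; omega)
    · have h₁ := hQ' _ hp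
      have h₂ := hP' q hq
      dsimp only at h₁
      refine ⟨fun h => ?_, fun h => ?_, fun h => h₁.1.2 q hq h.symm, fun h => ?_⟩ <;>
        (have := congrArg Finset.card h; omega)
    · have h₁ := hQ' _ hp
      have h₂ := hQ' _ hq
      dsimp only at h₁ h₂
      have hne : (p.2, p.1) ≠ (q.2, q.1) := fun h =>
        hpq (Prod.ext (Prod.ext_iff.1 h).2 (Prod.ext_iff.1 h).1)
      refine ⟨fun h => hne (hQ.eq_of_snd_eq hp hq h), fun h => ?_, fun h => ?_,
        fun h => hne (hQ.eq_of_fst_eq hp hq h)⟩ <;> (have := congrArg Finset.card h; omega)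
  · have hrank : ∀ a b, K.ReversedHasse {p | p ∈ combine P Q} a b → rank P Q b < rank P Q a := by
      rintro a b (⟨⟨hb, ha, hba, hcard⟩, hM⟩ | ⟨-, hM⟩)
      · have h3 := K.card_le_three a ha
        have h1 := (nonempty_of_mem hb).card_pos
        simp only [Set.mem_ofPred_eq, mem_combine, not_or] at hM
        obtain h2 | h2 : b.card = 2 ∨ b.card = 1 := by omega
        · have ha3 : a.card = 3 := by omega
          simp only [rank, ha3, h2, reduceIte, Nat.reduceEqDiff]
          split_ifs with hbP hbQ
          · obtain ⟨p, hp, rfl⟩ := List.mem_map.1 hbP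
            rw [hPfst p hp]
            by_cases haP : a ∈ P.map Prod.snd
            · obtain ⟨q, hq, rfl⟩ := List.mem_map.1 haP
              rw [hPsnd q hq]
              have := hP.idxOf_lt hq hp (fun h => hM.1 (h ▸ hp)) (comparable_of_subset hba)
              omega
            · rw [List.idxOf_of_notMem haP, List.length_map]
              have := hPlt p hp
              omega
          · omega
          · omega
        · have ha2 : a.card = 2 := by omega
          simp only [rank, ha2, h2, reduceIte, Nat.reduceEqDiff,
            OfNat.one_ne_ofNat]
          split_ifs with haP haQ
          · omega
          · obtain ⟨q, hq, rfl⟩ := List.mem_map.1 haQ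
            rw [hQfst q hq]
            have hlt := hQlt q hq
            by_cases hbQ : b ∈ Q.map Prod.snd
            · obtain ⟨p, hp, rfl⟩ := List.mem_map.1 hbQ
              rw [hQsnd p hp]
              have := hQ.idxOf_lt hp hq (fun h => hM.2 (h ▸ hp)) (comparable_of_superset hba)
              omega
            · rw [List.idxOf_of_notMem hbQ, List.length_map]
              omega
          · omega
      · rcases mem_combine.1 hM with hp | hp
        · have h₁ := hPfst _ hp
          have h₂ := hPsnd _ hp
          have h₃ : a ∈ P.map Prod.fst := List.mem_map_of_mem (f := Prod.fst) hp
          obtain ⟨⟨-, h₄⟩, -, h₅⟩ := hP' _ hp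
          dsimp only at h₁ h₂ h₄ h₅
          rw [rank, rank, h₄, h₅]
          simp only [h₃, h₁, h₂, reduceIte, Nat.reduceEqDiff]
          omega
        · have h₁ := hQfst _ hp
          have h₂ := hQsnd _ hp
          have h₃ : b ∈ Q.map Prod.fst := List.mem_map_of_mem (f := Prod.fst) hp
          obtain ⟨⟨⟨-, h₄⟩, h₆⟩, -, h₅⟩ := hQ' _ hp
          have h₇ := hQlt _ hp
          have h₈ : b ∉ P.map Prod.fst := fun h => by
            obtain ⟨p, hp', hpb⟩ := List.mem_map.1 h
            exact h₆ p hp' hpb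
          dsimp only at h₁ h₂ h₄ h₅ h₇
          rw [rank, rank, h₄, h₅]
          simp only [h₈, h₃, h₁, h₂, reduceIte, Nat.reduceEqDiff,
            OfNat.one_ne_ofNat]
          omega
    have key : ∀ a b, Relation.TransGen (K.ReversedHasse {p | p ∈ combine P Q}) a b →
        rank P Q b < rank P Q a := by
      intro a b h
      induction h with
      | single h => exact hrank _ _ h
      | tail _ h ih => exact (hrank _ _ h).trans ih
    exact fun s hs => lt_irrefl _ (key s s hs)

end Feasible

/-! ### Lower bounds for arbitrary Morse matchings -/

section LowerBound

variable {M : Set (Finset ℕ × Finset ℕ)}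

/-- Triangles that are matched in a Morse matching can be removed greedily. -/
theorem exists_filter_eq_singleton (hM : K.IsMorseMatching M) {S : List (Finset ℕ)}
    (hS : S.Nodup) (hS₀ : S ≠ []) (hSK : ∀ t ∈ S, t ∈ K.withCard 3 ∧ ∃ p ∈ M, p.2 = t) :
    ∃ e ∈ K.withCard 2, ∃ t, S.filter (comparable e) = [t] := by
  -- No triangle of `S` leads to `t`. If the edge `e` matched with `t` were in another triangle `u`
  -- of `S`, then `u`, `e`, `t` would be a directed path.
  obtain ⟨t, ht, hmin⟩ := exists_forall_not_transGen hM.acyclic (S := S.toFinset)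
    ((List.toFinset_nonempty_iff S).2 hS₀)
  rw [List.mem_toFinset] at ht
  obtain ⟨htK, ⟨e, t⟩, hp, rfl⟩ := hSK t ht
  obtain ⟨h₁, h₂, h₃, h₄⟩ := hM.isFacet _ hp
  dsimp only at *
  rw [mem_withCard] at htK
  refine ⟨e, mem_withCard.2 ⟨h₁, by omega⟩, t, (hS.filter _).eq_singleton
    (List.mem_filter.2 ⟨ht, comparable_of_subset h₃⟩) fun u hu => ?_⟩
  obtain ⟨hu, heu⟩ := List.mem_filter.1 hu
  by_contra hut
  have huK := mem_withCard.1 (hSK u hu).1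
  have hsub := subset_of_comparable heu (by omega)
  refine hmin u (List.mem_toFinset.2 hu) (.tail (.single (.inl
    ⟨⟨h₁, huK.1, hsub, by omega⟩, fun h => ?_⟩)) (.inr ⟨⟨h₁, h₂, h₃, h₄⟩, hp⟩))
  exact (hM.disjoint _ h _ hp (by simp [hut])).1 rfl

/-- Every nonempty union of connected components contains a critical vertex. -/
theorem exists_critical_mem (hM : K.IsMorseMatching M) {Y : Finset (Finset ℕ)}
    (hY : IsClosedUnder comparable (K.withCard 2) (K.withCard 1) Y)
    (h : ∃ u ∈ K.withCard 1, u ∈ Y) :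
    ∃ v ∈ K.withCard 1, v ∈ Y ∧ ∀ p ∈ M, p.1 ≠ v := by
  obtain ⟨u, huK, huY⟩ := h
  have hacyc : ∀ a, ¬ Relation.TransGen (Function.swap (K.ReversedHasse M)) a a := fun a ha =>
    hM.acyclic a (Relation.transGen_swap.1 ha)
  -- From `v` no vertex in `Y` can be reached. If `v` were matched with an edge `e`, there would be
  -- a path through `e` to its other endpoint, which lies in `Y` by closedness.
  obtain ⟨v, hv, hmax⟩ := exists_forall_not_transGen hacyc
    (S := (K.withCard 1).toFinset ∩ Y) ⟨u, by simp [huK, huY]⟩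
  simp only [Finset.mem_inter, List.mem_toFinset] at hv hmax
  refine ⟨v, hv.1, hv.2, ?_⟩
  rintro ⟨v, e⟩ hp rfl
  obtain ⟨h₁, h₂, h₃, h₄⟩ := hM.isFacet _ hp
  dsimp only at *
  have hv1 := (mem_withCard.1 hv.1).2
  have hcard : (e \ v).card = 1 := by rw [Finset.card_sdiff_of_subset h₃]; omega
  have hwK : e \ v ∈ K.faces :=
    mem_of_subset h₂ Finset.sdiff_subset (Finset.card_pos.1 (by omega))
  have hw : e \ v ∈ K.withCard 1 := mem_withCard.2 ⟨hwK, hcard⟩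
  have hne : e \ v ≠ v := by
    intro h
    have := Finset.disjoint_sdiff (s := v) (t := e)
    rw [h, disjoint_self, Finset.bot_eq_empty] at this
    simp [this] at hv1
  have hwY := hY e (mem_withCard.2 ⟨h₂, by omega⟩) v hv.1 _ hw (comparable_of_superset h₃)
    (comparable_of_superset Finset.sdiff_subset) hv.2
  refine hmax _ ⟨hw, hwY⟩ (Relation.transGen_swap.2 (.tail (.single (.inr
    ⟨⟨h₁, h₂, h₃, h₄⟩, hp⟩)) (.inl ⟨⟨hwK, h₂, Finset.sdiff_subset, by omega⟩, fun h => ?_⟩)))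
  exact (hM.disjoint _ h _ hp (by simp [hne])).2.2.2 rfl

/-- Removing edges by collapses does not disconnect anything. -/
theorem isClosedUnder_of_unmatched {P : List (Finset ℕ × Finset ℕ)}
    (hP : IsCollapseSeq comparable P)
    (hP' : ∀ p ∈ P, p.1 ∈ K.withCard 2 ∧ p.2 ∈ K.withCard 3) {Y : Finset (Finset ℕ)}
    (hY : IsClosedUnder comparable (unmatched (K.withCard 2) P) (K.withCard 1) Y) :
    IsClosedUnder comparable (K.withCard 2) (K.withCard 1) Y := by
  -- Induction on a bound for the position of the pair of `e`. If `e` is collapsed through `t`, then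
  -- its endpoints are joined through the opposite vertex `t \ e` by the other two edges of `t`. If
  -- these belong to pairs of `P` at all, those pairs stand before that of `e`.
  have key : ∀ n, ∀ e ∈ K.withCard 2, (∀ p ∈ P, p.1 = e → P.idxOf p < n) →
      ∀ u ∈ K.withCard 1, ∀ v ∈ K.withCard 1, comparable e u → comparable e v → u ∈ Y → v ∈ Y := by
    intro n
    induction n with
    | zero =>
      exact fun e he h => hY e (mem_unmatched.2 ⟨he, fun p hp hpe => by
        simpa using h p hp hpe⟩)
    | succ n ih =>
      intro e he h u hu v hv heu hev huY
      by_cases hex : ∃ p ∈ P, p.1 = e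
      swap
      · push Not at hex
        exact hY e (mem_unmatched.2 ⟨he, hex⟩) u hu v hv heu hev huY
      obtain ⟨⟨e, t⟩, hp, rfl⟩ := hex
      have hpn := h _ hp rfl
      have het := hP.adj_of_mem _ hp
      have ht := (hP' _ hp).2
      dsimp only at *
      by_cases huv : u = v
      · exact huv ▸ huY
      rw [mem_withCard] at he ht
      have hu' := mem_withCard.1 hu
      have hv' := mem_withCard.1 hv
      have het := subset_of_comparable het (by omega)
      have hue := superset_of_comparable heu (by omega)
      have hve := superset_of_comparable hev (by omega)
      have hcard : (t \ e).card = 1 := by rw [Finset.card_sdiff_of_subset het]; omega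
      have hwK : t \ e ∈ K.withCard 1 := mem_withCard.2 ⟨mem_of_subset ht.1
        Finset.sdiff_subset (Finset.card_pos.1 (by omega)), hcard⟩
      have hedge : ∀ x : Finset ℕ, x.card = 1 → x ⊆ e → x ∪ (t \ e) ∈ K.withCard 2 ∧
          ∀ p ∈ P, p.1 = x ∪ (t \ e) → P.idxOf p < n := by
        intro x hx hxe
        have hsub : x ∪ (t \ e) ⊆ t := Finset.union_subset (hxe.trans het) Finset.sdiff_subset
        have hc : (x ∪ (t \ e)).card = 2 := by
          rw [Finset.card_union_of_disjoint (Finset.disjoint_sdiff.mono_left hxe)]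
          omega
        refine ⟨mem_withCard.2 ⟨mem_of_subset ht.1 hsub (Finset.card_pos.1 (by omega)), hc⟩, ?_⟩
        intro q hq hqx
        have hne : (e, t) ≠ q := by
          rintro rfl
          obtain ⟨w, hw⟩ := Finset.card_pos.1 (hcard ▸ one_pos)
          have : w ∈ e := by
            dsimp only at hqx
            rw [hqx]
            exact Finset.mem_union_right _ hw
          exact (Finset.mem_sdiff.1 hw).2 this
        have := hP.idxOf_lt hp hq hne (by rw [hqx]; exact comparable_of_subset hsub)
        omega
      obtain ⟨hu₁, hu₂⟩ := hedge u hu'.2 hue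
      obtain ⟨hv₁, hv₂⟩ := hedge v hv'.2 hve
      refine ih _ hv₁ hv₂ _ hwK _ hv (comparable_of_superset Finset.subset_union_right)
        (comparable_of_superset Finset.subset_union_left) ?_
      exact ih _ hu₁ hu₂ _ hu _ hwK (comparable_of_superset Finset.subset_union_left)
        (comparable_of_superset Finset.subset_union_right) huY
  exact fun e he => key P.length e he fun p hp _ => List.idxOf_lt_length_iff.2 hp

/-! ### Counting pairs and critical simplices -/

theorem ncard_criticalSimplices_add (hM : K.IsMorseMatching M) :
    (K.criticalSimplices M).ncard + 2 * M.ncard = K.list.length := by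
  classical
  let F := K.list.toFinset
  have hF : ∀ s, s ∈ F ↔ s ∈ K.faces := fun s => by simp [F, K.mem_list]
  have hfin : M.Finite := (F ×ˢ F).finite_toSet.subset fun p hp => by
    have := hM.isFacet p hp
    simp [hF, this.1, this.2.1]
  let N := hfin.toFinset
  have hN : ∀ p, p ∈ N ↔ p ∈ M := fun p => by simp [N]
  have hcrit : K.criticalSimplices M = ↑(F \ (N.image Prod.fst ∪ N.image Prod.snd)) := by
    ext s
    simp only [PreAbstractSimplicialComplex.criticalSimplices, Set.mem_ofPred_eq, Finset.coe_sdiff,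
      Set.mem_sdiff, Finset.mem_coe, hF, Finset.mem_union, Finset.mem_image, hN]
    refine and_congr_right fun _ => ⟨fun h => ?_, fun h p hp => ?_⟩
    · rintro (⟨p, hp, rfl⟩ | ⟨p, hp, rfl⟩)
      exacts [(h p hp).1 rfl, (h p hp).2 rfl]
    · exact ⟨fun hs => h (.inl ⟨p, hp, hs.symm⟩), fun hs => h (.inr ⟨p, hp, hs.symm⟩)⟩
  have hdisj : Disjoint (N.image Prod.fst) (N.image Prod.snd) := by
    rw [Finset.disjoint_left]
    intro s h₁ h₂
    obtain ⟨p, hp, rfl⟩ := Finset.mem_image.1 h₁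
    obtain ⟨q, hq, hqp⟩ := Finset.mem_image.1 h₂
    rw [hN] at hp hq
    by_cases hpq : p = q
    · subst hpq
      have := (hM.isFacet p hp).2.2.2
      rw [hqp] at this
      omega
    · exact (hM.disjoint p hp q hq hpq).2.1 hqp.symm
  have h₁ : (N.image Prod.fst).card = N.card := Finset.card_image_of_injOn fun p hp q hq h => by
    by_contra hpq
    exact (hM.disjoint p ((hN p).1 hp) q ((hN q).1 hq) hpq).1 h
  have h₂ : (N.image Prod.snd).card = N.card := Finset.card_image_of_injOn fun p hp q hq h => by
    by_contra hpq
    exact (hM.disjoint p ((hN p).1 hp) q ((hN q).1 hq) hpq).2.2.2 h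
  have hsub : N.image Prod.fst ∪ N.image Prod.snd ⊆ F := by
    intro s hs
    rcases Finset.mem_union.1 hs with hs | hs <;> obtain ⟨p, hp, rfl⟩ := Finset.mem_image.1 hs
    · exact (hF _).2 (hM.isFacet p ((hN p).1 hp)).1
    · exact (hF _).2 (hM.isFacet p ((hN p).1 hp)).2.1
  have h₃ := Finset.card_sdiff_add_card_eq_card hsub
  rw [Finset.card_union_of_disjoint hdisj, h₁, h₂] at h₃
  rw [hcrit, Set.ncard_coe_finset, Set.ncard_eq_toFinset_card _ hfin,
    ← List.toFinset_card_of_nodup K.nodup_list]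
  change _ + 2 * N.card = F.card
  omega

open scoped Classical in
/-- The critical triangles of `M`. -/
noncomputable def criticalTriangles (K : TwoComplex) (M : Set (Finset ℕ × Finset ℕ)) :
    Finset (Finset ℕ) :=
  (K.withCard 3).toFinset.filter fun t => ∀ p ∈ M, p.2 ≠ t

open scoped Classical in
/-- The critical vertices of `M`. -/
noncomputable def criticalVertices (K : TwoComplex) (M : Set (Finset ℕ × Finset ℕ)) :
    Finset (Finset ℕ) :=
  (K.withCard 1).toFinset.filter fun v => ∀ p ∈ M, p.1 ≠ v

theorem mem_criticalTriangles {t : Finset ℕ} :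
    t ∈ K.criticalTriangles M ↔ t ∈ K.withCard 3 ∧ ∀ p ∈ M, p.2 ≠ t := by
  simp [criticalTriangles]

theorem mem_criticalVertices {v : Finset ℕ} :
    v ∈ K.criticalVertices M ↔ v ∈ K.withCard 1 ∧ ∀ p ∈ M, p.1 ≠ v := by
  simp [criticalVertices]

/-- A pair contains either a triangle or a vertex, but not both. Distinct pairs supply distinct such
simplices, none of which is critical. -/
theorem ncard_add_critical_le (hM : K.IsMorseMatching M) :
    M.ncard + (K.criticalTriangles M).card + (K.criticalVertices M).card ≤
      (K.withCard 3).length + (K.withCard 1).length := by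
  classical
  have hT := Finset.card_sdiff_add_card_eq_card
    (s := K.criticalTriangles M) (t := (K.withCard 3).toFinset)
    fun t ht => List.mem_toFinset.2 (mem_criticalTriangles.1 ht).1
  have hV := Finset.card_sdiff_add_card_eq_card
    (s := K.criticalVertices M) (t := (K.withCard 1).toFinset)
    fun v hv => List.mem_toFinset.2 (mem_criticalVertices.1 hv).1
  have hle : M.ncard ≤ ((K.withCard 3).toFinset \ K.criticalTriangles M ∪
      (K.withCard 1).toFinset \ K.criticalVertices M).card := by
    rw [← Set.ncard_coe_finset]
    refine Set.ncard_le_ncard_of_injOn (fun p => if p.2.card = 3 then p.2 else p.1) ?_ ?_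
      (Finset.finite_toSet _)
    · intro p hp
      obtain ⟨h₁, h₂, -, h₄⟩ := hM.isFacet p hp
      have h₅ := (nonempty_of_mem h₁).card_pos
      have h₆ := K.card_le_three _ h₂
      split_ifs with h
      · exact Finset.mem_union_left _ (Finset.mem_sdiff.2
          ⟨List.mem_toFinset.2 (mem_withCard.2 ⟨h₂, h⟩),
            fun hc => (mem_criticalTriangles.1 hc).2 p hp rfl⟩)
      · exact Finset.mem_union_right _ (Finset.mem_sdiff.2
          ⟨List.mem_toFinset.2 (mem_withCard.2 ⟨h₁, by omega⟩),
            fun hc => (mem_criticalVertices.1 hc).2 p hp rfl⟩)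
    · intro p hp q hq hpq
      by_contra hne
      obtain ⟨h₁, h₂, h₃, h₄⟩ := hM.disjoint p hp q hq hne
      dsimp only at hpq
      split_ifs at hpq <;> contradiction
  have := hle.trans (Finset.card_union_le _ _)
  rw [List.toFinset_card_of_nodup (nodup_withCard _)] at hT hV
  omega

/-- In dimension at most two a triangle is never the lower simplex of a pair, so testing second
components suffices. -/
theorem card_criticalTriangles_le (hM : K.IsMorseMatching M) :
    (K.criticalTriangles M).card ≤ (K.criticalSimplices M).ncard := by
  classical
  rw [← Set.ncard_coe_finset]
  refine Set.ncard_le_ncard ?_ (K.list.toFinset.finite_toSet.subset fun s hs => ?_)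
  · intro t ht
    obtain ⟨h₁, h₂⟩ := mem_criticalTriangles.1 (Finset.mem_coe.1 ht)
    rw [mem_withCard] at h₁
    refine ⟨h₁.1, fun p hp => ⟨?_, (h₂ p hp).symm⟩⟩
    rintro rfl
    obtain ⟨-, h₃, -, h₄⟩ := hM.isFacet p hp
    have := K.card_le_three _ h₃
    omega
  · simpa [K.mem_list] using hs.1

end LowerBound

/-! ### The approximation factor -/

theorem isCollapseSeq_upperPairs : IsCollapseSeq comparable (upperPairs K.list) ∧
    ∀ p ∈ upperPairs K.list, p.1 ∈ K.withCard 2 ∧ p.2 ∈ K.withCard 3 :=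
  isCollapseSeq_bestGreedy

theorem isCollapseSeq_lowerPairs : IsCollapseSeq comparable (lowerPairs K.list) ∧
    ∀ p ∈ lowerPairs K.list,
      p.1 ∈ unmatched (K.withCard 2) (upperPairs K.list) ∧ p.2 ∈ K.withCard 1 :=
  isCollapseSeq_greedy

theorem isMorseMatching_approxMatching : K.IsMorseMatching {p | p ∈ approxMatching K.list} :=
  isMorseMatching_combine isCollapseSeq_upperPairs.1 isCollapseSeq_lowerPairs.1
    isCollapseSeq_upperPairs.2 isCollapseSeq_lowerPairs.2

theorem ncard_approxMatching : {p | p ∈ approxMatching K.list}.ncard =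
    (upperPairs K.list).length + (lowerPairs K.list).length := by
  have hnodup : (approxMatching K.list).Nodup := by
    refine List.nodup_append'.2 ⟨isCollapseSeq_upperPairs.1.nodup,
      isCollapseSeq_lowerPairs.1.nodup.map Prod.swap_injective, ?_⟩
    intro p hp hp'
    obtain ⟨q, hq, rfl⟩ := List.mem_map.1 hp'
    have h₁ := mem_withCard.1 (isCollapseSeq_upperPairs.2 _ hp).1
    have h₂ := mem_withCard.1 (isCollapseSeq_lowerPairs.2 _ hq).2
    dsimp only at h₁
    omega
  have : {p | p ∈ approxMatching K.list} = ↑(approxMatching K.list).toFinset := by ext; simp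
  rw [this, Set.ncard_coe_finset, List.toFinset_card_of_nodup hnodup, approxMatching,
    List.length_append, List.length_map]

/-- An edge has only two vertices, and each union of components of the graph left by the upper pairs
is one of the full 1-skeleton, hence contains a critical vertex of `M`. -/
theorem length_withCard_one_le {M : Set (Finset ℕ × Finset ℕ)} (hM : K.IsMorseMatching M) :
    (K.withCard 1).length ≤ (lowerPairs K.list).length + (K.criticalVertices M).card := by
  classical
  refine length_le_length_greedy_add (nodup_withCard 1) ?_ _ ?_
  · intro e he u hu v hv w hw heu hev hew
    have he := (mem_withCard.1 (mem_unmatched.1 he).1).2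
    have hu := (mem_withCard.1 hu).2
    have hv := (mem_withCard.1 hv).2
    have hw := (mem_withCard.1 hw).2
    have heu := superset_of_comparable heu (by omega)
    have hev := superset_of_comparable hev (by omega)
    have hew := superset_of_comparable hew (by omega)
    obtain ⟨a, rfl⟩ := Finset.card_eq_one.1 hu
    obtain ⟨b, rfl⟩ := Finset.card_eq_one.1 hv
    obtain ⟨c, rfl⟩ := Finset.card_eq_one.1 hw
    by_contra! h
    simp only [ne_eq, Finset.singleton_inj] at h
    have h₁ : ({a, b, c} : Finset ℕ) ⊆ e := by
      intro x hx
      simp only [Finset.mem_insert, Finset.mem_singleton] at hx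
      rcases hx with rfl | rfl | rfl
      exacts [heu (by simp), hev (by simp), hew (by simp)]
    have h₂ := Finset.card_le_card h₁
    rw [Finset.card_eq_three.2 ⟨a, b, c, h.1, h.2.1, h.2.2, rfl⟩] at h₂
    omega
  · intro Y hY h
    obtain ⟨v, hv, hvY, hvM⟩ := exists_critical_mem hM
      (isClosedUnder_of_unmatched isCollapseSeq_upperPairs.1 isCollapseSeq_upperPairs.2 hY) h
    exact ⟨v, mem_criticalVertices.2 ⟨hv, hvM⟩, hvY⟩

/-- For the mask that covers the critical triangles of `M`, all remaining triangles are matched in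
`M`, so greedy removes every one of them. -/
theorem exists_length_withCard_three_le {M : Set (Finset ℕ × Finset ℕ)}
    (hM : K.IsMorseMatching M) :
    ∃ g, (K.withCard 3).length < 2 ^ g ∧ (K.withCard 3 ≠ [] → 0 < g) ∧
      (K.withCard 3).length ≤ (upperPairs K.list).length +
        (K.criticalTriangles M).card * ((K.withCard 3).length / g + 1) := by
  obtain ⟨g, hg, hg₀, m, hm, hmC, hle⟩ :=
    exists_mask_thin (K.withCard 3) (nodup_withCard 3) (K.criticalTriangles M)
  refine ⟨g, hg, hg₀, hle.trans (Nat.add_le_add_right ?_ _)⟩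
  have hsub := thin_sublist_reverse m (K.withCard 3)
  have hnodup : (thin m (K.withCard 3)).Nodup :=
    hsub.nodup (List.nodup_reverse.2 (nodup_withCard 3))
  have h₁ : (greedy comparable (K.withCard 2) (thin m (K.withCard 3))).length =
      (thin m (K.withCard 3)).length := by
    refine length_greedy_of_forall hnodup fun S' hS' hne => ?_
    refine exists_filter_eq_singleton hM (hS'.nodup hnodup) hne fun t ht => ?_
    have ht' := hS'.subset ht
    have htK : t ∈ K.withCard 3 := List.mem_reverse.1 (hsub.subset ht')
    refine ⟨htK, ?_⟩
    by_contra! h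
    exact hmC t ht' (mem_criticalTriangles.2 ⟨htK, h⟩)
  rw [← h₁]
  exact (bestGreedy_spec (K.withCard 2) (K.withCard 3)).2 m hm

/-- The approximation factor of the algorithm. -/
noncomputable def factor (n : ℕ) : ℝ := 5 + 2 * (n / Real.log n)

theorem factor_isBigO : factor =O[Filter.atTop] fun n : ℕ => (n : ℝ) / Real.log n := by
  -- Since `n / log n ≥ 1`, the constant is `5 + 2`.
  refine Asymptotics.IsBigO.of_bound 7 ?_
  filter_upwards [Filter.eventually_ge_atTop 2] with n hn
  have hn' : (1 : ℝ) < n := by exact_mod_cast hn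
  have hlog : 0 < Real.log n := Real.log_pos hn'
  have h : 1 ≤ (n : ℝ) / Real.log n := by
    rw [one_le_div hlog]
    exact (Real.log_le_sub_one_of_pos (by linarith)).trans (by linarith)
  have h₀ : 0 ≤ factor n := by unfold factor; linarith
  rw [Real.norm_of_nonneg h₀, Real.norm_of_nonneg (by linarith), factor]
  linarith

theorem div_add_one_le_factor {n g : ℕ} (hg : n < 2 ^ g) (hg₀ : n ≠ 0 → 0 < g) :
    ((1 + 2 * (n / g + 1) : ℕ) : ℝ) ≤ factor n := by
  have hdiv : ((n / g : ℕ) : ℝ) ≤ n / g := Nat.cast_div_le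
  push_cast
  unfold factor
  -- For `n < 2` the logarithm is zero, and so is `n / log n` by convention; the constant `5 = 3 +
  -- 2` absorbs `n / g ≤ 1`.
  rcases Nat.lt_or_ge n 2 with hn | hn
  · have h₁ : n / g ≤ 1 := (Nat.div_le_self n g).trans (by omega)
    have h₂ : ((n / g : ℕ) : ℝ) ≤ 1 := by exact_mod_cast h₁
    have h₃ : Real.log n = 0 := by interval_cases n <;> simp
    rw [h₃, div_zero]
    linarith
  · have hn' : (1 : ℝ) < n := by exact_mod_cast hn
    have hlog : 0 < Real.log n := Real.log_pos hn'
    have h₁ : Real.log n ≤ g := by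
      have h₂ : (n : ℝ) ≤ 2 ^ g := by exact_mod_cast hg.le
      have h₃ := Real.log_le_log (by linarith) h₂
      rw [Real.log_pow] at h₃
      have h₄ : Real.log 2 ≤ 1 := (Real.log_le_sub_one_of_pos (by norm_num)).trans (by norm_num)
      nlinarith [(Nat.cast_nonneg g : (0 : ℝ) ≤ g)]
    have h₂ : (n : ℝ) / g ≤ n / Real.log n := by gcongr
    linarith

theorem ncard_criticalSimplices_approxMatching_le {M : Set (Finset ℕ × Finset ℕ)}
    (hM : K.IsMorseMatching M) :
    ((K.criticalSimplices {p | p ∈ approxMatching K.list}).ncard : ℝ) ≤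
      factor K.numTwoSimplices * (K.criticalSimplices M).ncard := by
  have h₁ := ncard_criticalSimplices_add (isMorseMatching_approxMatching (K := K))
  rw [ncard_approxMatching] at h₁
  have h₂ := ncard_criticalSimplices_add hM
  have h₃ := ncard_add_critical_le hM
  have h₄ := card_criticalTriangles_le hM
  have h₅ := length_withCard_one_le hM
  obtain ⟨g, hg, hg₀, h₆⟩ := exists_length_withCard_three_le hM
  -- The bounds on both kinds of pairs show that the output has at most `c * (n / g + 1)` pairs
  -- fewer than `M`, where `c` counts the critical triangles of `M`. Each missing pair costs two
  -- critical simplices, and `c` is at most the number of critical simplices of `M`.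
  have h₇ : (K.criticalSimplices {p | p ∈ approxMatching K.list}).ncard ≤
      (1 + 2 * ((K.withCard 3).length / g + 1)) * (K.criticalSimplices M).ncard := by
    have h₈ := Nat.mul_le_mul_right ((K.withCard 3).length / g + 1) h₄
    have h₉ : (1 + 2 * ((K.withCard 3).length / g + 1)) * (K.criticalSimplices M).ncard =
      (K.criticalSimplices M).ncard +
        2 * ((K.criticalSimplices M).ncard * ((K.withCard 3).length / g + 1)) := by ring
    omega
  rw [numTwoSimplices_eq]
  refine (Nat.cast_le.2 h₇).trans ?_
  rw [Nat.cast_mul]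
  refine mul_le_mul_of_nonneg_right (div_add_one_le_factor hg fun h => hg₀ ?_) (Nat.cast_nonneg _)
  rintro h'
  simp [h'] at h

end TwoComplex

theorem mainTheorem6 :
    ∃ α : ℕ → ℝ, α =O[Filter.atTop] (fun n : ℕ => (n : ℝ) / Real.log (n : ℝ)) ∧
      ∃ A : Prog, minMorseMatching.IsApproximationAlgorithm
        (fun K : TwoComplex => α K.numTwoSimplices) A := by
  obtain ⟨A, q, hA⟩ := PolyTime.approxMatching
  refine ⟨TwoComplex.factor, TwoComplex.factor_isBigO, A, q, fun K => ?_⟩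
  obtain ⟨t, hrun, ht⟩ := hA K.list
  refine ⟨approxMatching K.list, t, hrun, ht, TwoComplex.isMorseMatching_approxMatching, ?_⟩
  -- The infimum of a nonempty set of natural numbers is attained, so an optimal matching is
  -- available for comparison.
  obtain ⟨M, hM, hopt⟩ : minMorseMatching.opt K ∈
      {v | ∃ y, minMorseMatching.Feasible K y ∧ minMorseMatching.objective K y = v} :=
    Nat.sInf_mem (let ⟨y, hy⟩ := minMorseMatching.exists_feasible K; ⟨_, y, hy, rfl⟩)
  rw [← hopt]
  exact TwoComplex.ncard_criticalSimplices_approxMatching_le hM
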